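/- Let $\mathcal P=\langle x_1,\dots,x_n\mid r_1,\dots,r_n\rangle$ be a balanced finite presentation of a group (the relators being words in the $x_i^{\pm1}$), let $K_{\mathcal P}$ be its standard 2-complex (one 0-cell, a 1-cell for each generator, a 2-cell attached along each relator), and let $K'_{\mathcal P}$ be the barycentric subdivision of $K_{\mathcal P}$, a regular CW-complex. (For an empty relator the boundary of the 2-cell is regarded as a single 1-cell mapped to the 0-cell, so that its subdivision consists of two 1-cells and two 2-cells forming, together with the 0-cell and the barycenter, a 2-sphere.) Let $\mathcal X(K'_{\mathcal P})$ be the face poset of $K'_{\mathcal P}$, and let $M$ be an acyclic matching in $\mathcal X(K'_{\mathcal P})$, i.e. a set of pairs $(e,e')$ with $e'$ covering $e$ such that every cell lies in at most one pair and the Hasse diagram with the edges of $M$ reversed has no directed cycle. Suppose that exactly one 0-cell is critical (lies in no pair of $M$). For $K=K'_{\mathcal P}$ the Morse presentation $\mathcal Q_{K,M}$ is obtained as follows. Orient the 1-cells and, for each 2-cell, choose a base point on its boundary and a direction for reading its attaching map. Let $\mathcal Q_0$ have as generators the 1-cells not matched in $M$ with a 0-cell, and as relators, one for each 2-cell, the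 boundary words with all occurrences of the 1-cells that are matched with a 0-cell deleted. Let $(x_1,e_1),\dots,(x_m,e_m)$ be an enumeration, in any order, of the pairs of $M$ formed by a 1-cell and a 2-cell. For $1\le i\le m$, the relator of $e_i$ in $\mathcal Q_{i-1}$ is $w_1x_i^{\epsilon}w_2$ with $\epsilon=\pm1$ and $x_i$ not occurring in $w_1,w_2$; $\mathcal Q_i$ is obtained from $\mathcal Q_{i-1}$ by removing this relator and the generator $x_i$ and replacing $x_i$ by $(w_1^{-1}w_2^{-1})^{\epsilon}$ in all the other relators. Then $\mathcal Q_{K,M}=\mathcal Q_m$. For all these choices, $\mathcal P$ is $Q^{**}$-equivalent to $\mathcal Q_{K'_{\mathcal P},M}$: up to the names of generators and relators, it can be transformed into $\mathcal Q_{K'_{\mathcal P},M}$ by a finite sequence of the following operations: (1) replace a relator $r_i$ by $r_i^{-1}$; (2) replace $r_i$ by $r_ir_j$ for some $j\ne i$; (3) replace $r_i$ by $wr_iw^{-1}$ with $w$ in the free group on the generators; (4) add a new generator and a relator equal to it, or the inverse of this operation; (5) apply an automorphism of the free group on the generators to all the relators. -/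

import Mathlib

noncomputable section

/-! ### Group presentations and `Q**`-transformations -/

/-- A finite presentation: a finite set of generators, a finite indexed family of relators, each an
element of the free group on the generators. -/
structure GroupPresentation where
  Gen : Type
  Rel : Type
  [finGen : Finite Gen]
  [finRel : Finite Rel]
  rel : Rel → FreeGroup Gen

/-- The transformations (1)-(5). The constructor `relabel` only changes the names of the generators
and of the indices of the relators. -/
inductive QStep : GroupPresentation → GroupPresentation → Prop
  /-- (1) replace `rᵢ` by its inverse. -/
  | inv {α ρ : Type} [Finite α] [Finite ρ] [DecidableEq ρ] (r : ρ → FreeGroup α) (i : ρ) :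
      QStep ⟨α, ρ, r⟩ ⟨α, ρ, Function.update r i (r i)⁻¹⟩
  /-- (2) replace `rᵢ` by `rᵢ rⱼ` with `j ≠ i`. -/
  | mul {α ρ : Type} [Finite α] [Finite ρ] [DecidableEq ρ] (r : ρ → FreeGroup α) (i j : ρ)
      (hij : j ≠ i) : QStep ⟨α, ρ, r⟩ ⟨α, ρ, Function.update r i (r i * r j)⟩
  /-- (3) replace `rᵢ` by a conjugate. -/
  | conj {α ρ : Type} [Finite α] [Finite ρ] [DecidableEq ρ] (r : ρ → FreeGroup α) (i : ρ)
      (w : FreeGroup α) : QStep ⟨α, ρ, r⟩ ⟨α, ρ, Function.update r i (w * r i * w⁻¹)⟩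
  /-- (4) add a new generator (`none`) and a new relator equal to it. -/
  | add {α ρ : Type} [Finite α] [Finite ρ] (r : ρ → FreeGroup α) :
      QStep ⟨α, ρ, r⟩ ⟨Option α, Option ρ,
        fun o => o.elim (FreeGroup.of none) (fun j => FreeGroup.map some (r j))⟩
  /-- (4), inverse operation. -/
  | remove {α ρ : Type} [Finite α] [Finite ρ] (r : ρ → FreeGroup α) :
      QStep ⟨Option α, Option ρ,
        fun o => o.elim (FreeGroup.of none) (fun j => FreeGroup.map some (r j))⟩ ⟨α, ρ, r⟩
  /-- (5) apply an automorphism of the free group to all the relators. -/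
  | aut {α ρ : Type} [Finite α] [Finite ρ] (r : ρ → FreeGroup α)
      (φ : FreeGroup α ≃* FreeGroup α) : QStep ⟨α, ρ, r⟩ ⟨α, ρ, fun j => φ (r j)⟩
  | relabel {α β ρ σ : Type} [Finite α] [Finite β] [Finite ρ] [Finite σ] (r : ρ → FreeGroup α)
      (a : α ≃ β) (c : ρ ≃ σ) :
      QStep ⟨α, ρ, r⟩ ⟨β, σ, fun j => FreeGroup.map a (r (c.symm j))⟩

/-- `Q**`-equivalence: a finite sequence of transformations leads from `P` to `Q`. -/
def QEquiv (P Q : GroupPresentation) : Prop := Relation.ReflTransGen QStep P Q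

/-- A finite presentation whose relators are given as words in the generators and their inverses
(not necessarily reduced); `(x, true)` is `x` and `(x, false)` is `x⁻¹`. -/
structure WordPresentation where
  Gen : Type
  Rel : Type
  [finGen : Finite Gen]
  [finRel : Finite Rel]
  word : Rel → List (Gen × Bool)

attribute [instance] WordPresentation.finGen WordPresentation.finRel

namespace WordPresentation

def toPresentation (P : WordPresentation) : GroupPresentation :=
  ⟨P.Gen, P.Rel, fun j => FreeGroup.mk (P.word j)⟩

/-- As many relators as generators. -/
def Balanced (P : WordPresentation) : Prop := Nat.card P.Gen = Nat.card P.Rel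

end WordPresentation

/-! ### Combinatorial 2-complexes -/

/-- What a combinatorial map does to one 1-cell of the circle: it goes along an edge, forwards
(`true`) or backwards (`false`), or it is constant at a vertex. -/
inductive PathStep (V E : Type) where
  | edge (e : E) (b : Bool) : PathStep V E
  | const (v : V) : PathStep V E

namespace PathStep

variable {V E : Type}

def src (s t : E → V) : PathStep V E → V
  | edge e true => s e
  | edge e false => t e
  | const v => v

def tgt (s t : E → V) : PathStep V E → V
  | edge e true => t e
  | edge e false => s e
  | const v => v

/-- The letter contributed to the boundary word. -/
def letter? : PathStep V E → Option (E × Bool)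
  | edge e b => some (e, b)
  | const _ => none

end PathStep

/-- A finite combinatorial CW-complex of dimension at most 2, with oriented 1-cells. The attaching
map of a 2-cell `f` is a closed path of `len f ≥ 1` steps; the indices live in `Fin (len f)`, whose
addition is cyclic. -/
structure CombComplex where
  V : Type
  E : Type
  F : Type
  [finV : Finite V]
  [finE : Finite E]
  [finF : Finite F]
  src : E → V
  tgt : E → V
  len : F → ℕ
  [len_ne : ∀ f, NeZero (len f)]
  attach : (f : F) → Fin (len f) → PathStep V E
  closed : ∀ f i, (attach f i).tgt src tgt = (attach f (i + 1)).src src tgt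

attribute [instance] CombComplex.finV CombComplex.finE CombComplex.finF CombComplex.len_ne

namespace CombComplex

inductive Cell (K : CombComplex) where
  | vert (v : K.V) : Cell K
  | edge (e : K.E) : Cell K
  | face (f : K.F) : Cell K

variable {K : CombComplex}

/-- Proper faces. -/
def Cell.Lt : Cell K → Cell K → Prop
  | .vert v, .edge e => v = K.src e ∨ v = K.tgt e
  | .vert v, .face f => ∃ i, v = (K.attach f i).src K.src K.tgt
  | .edge e, .face f => ∃ i b, K.attach f i = .edge e b
  | _, _ => False

theorem Cell.Lt.trans {a b c : Cell K} (h : Cell.Lt a b) (h' : Cell.Lt b c) : Cell.Lt a c := by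
  cases a <;> cases b <;> cases c <;> simp only [Cell.Lt] at h h' ⊢
  rename_i v e f
  obtain ⟨i, b, hi⟩ := h'
  have hc := K.closed f i
  rcases h with h | h <;> cases b
  · exact ⟨i + 1, by rw [← hc, hi, h]; rfl⟩
  · exact ⟨i, by rw [hi, h]; rfl⟩
  · exact ⟨i, by rw [hi, h]; rfl⟩
  · exact ⟨i + 1, by rw [← hc, hi, h]; rfl⟩

theorem Cell.Lt.asymm {a b : Cell K} (h : Cell.Lt a b) : ¬ Cell.Lt b a := by
  cases a <;> cases b <;> simp_all [Cell.Lt]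

/-- The face poset `𝒳(K)`. -/
instance : PartialOrder (Cell K) where
  le a b := a = b ∨ Cell.Lt a b
  lt := Cell.Lt
  le_refl a := Or.inl rfl
  le_trans a b c h h' := by
    rcases h with rfl | h
    · exact h'
    · rcases h' with rfl | h'
      · exact Or.inr h
      · exact Or.inr (h.trans h')
  lt_iff_le_not_ge a b := by
    constructor
    · intro h
      refine ⟨Or.inr h, ?_⟩
      rintro (rfl | h')
      · exact h.asymm h
      · exact h.asymm h'
    · rintro ⟨rfl | h, h'⟩
      · exact absurd (Or.inl rfl) h'
      · exact h
  le_antisymm a b h h' := by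
    rcases h with h | h
    · exact h
    · rcases h' with h' | h'
      · exact h'.symm
      · exact absurd h' h.asymm

instance : Finite (Cell K) := by
  refine Finite.of_surjective
    (fun s : K.V ⊕ K.E ⊕ K.F => s.elim Cell.vert (fun t => t.elim Cell.edge Cell.face)) ?_
  rintro (v | e | f)
  · exact ⟨.inl v, rfl⟩
  · exact ⟨.inr (.inl e), rfl⟩
  · exact ⟨.inr (.inr f), rfl⟩

/-- The word read along the attaching map of a 2-cell. -/
def boundaryWord (K : CombComplex) (f : K.F) : List (K.E × Bool) :=
  (List.ofFn (K.attach f)).filterMap PathStep.letter?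

/-! ### Barycentric subdivision -/

/-- The barycenter of a boundary step: the barycenter of the edge, or the vertex at which the step
is constant. -/
def mid : PathStep K.V K.E → Cell K
  | .edge e _ => .edge e
  | .const v => .vert v

/-- The 1-cells of the subdivision. `half e false` is the half of `e` from `src e` to its
barycenter, `half e true` the half from the barycenter to `tgt e`. The spokes run from the
barycenter of `f` to the `i`-th corner of `f` (`spoke f i false`) and to the barycenter of its
`i`-th side (`spoke f i true`). -/
inductive SdEdge (K : CombComplex) where
  | half (e : K.E) (b : Bool) : SdEdge K
  | spoke (f : K.F) (i : Fin (K.len f)) (b : Bool) : SdEdge K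

instance : Finite (SdEdge K) := by
  refine Finite.of_surjective
    (fun s : (K.E × Bool) ⊕ (Σ f : K.F, Fin (K.len f) × Bool) =>
      s.elim (fun p => SdEdge.half p.1 p.2) (fun p => SdEdge.spoke p.1 p.2.1 p.2.2)) ?_
  rintro (⟨e, b⟩ | ⟨f, i, b⟩)
  · exact ⟨.inl (e, b), rfl⟩
  · exact ⟨.inr ⟨f, i, b⟩, rfl⟩

def SdEdge.src : SdEdge K → Cell K
  | .half e false => .vert (K.src e)
  | .half e true => .edge e
  | .spoke f _ _ => .face f

def SdEdge.tgt : SdEdge K → Cell K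
  | .half e false => .edge e
  | .half e true => .vert (K.tgt e)
  | .spoke f i false => .vert ((K.attach f i).src K.src K.tgt)
  | .spoke f i true => mid (K.attach f i)

/-- First half of a boundary step, as a step of the subdivision. -/
def firstHalf : PathStep K.V K.E → PathStep (Cell K) (SdEdge K)
  | .edge e true => .edge (.half e false) true
  | .edge e false => .edge (.half e true) false
  | .const v => .const (.vert v)

/-- Second half of a boundary step, as a step of the subdivision. -/
def secondHalf : PathStep K.V K.E → PathStep (Cell K) (SdEdge K)
  | .edge e true => .edge (.half e true) true
  | .edge e false => .edge (.half e false) false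
  | .const v => .const (.vert v)

/-- The two triangles of `f` at its `i`-th side: barycenter of `f`, `i`-th corner, barycenter of the
side (`false`), and barycenter of `f`, barycenter of the side, next corner (`true`). -/
def sdAttach (f : K.F) (i : Fin (K.len f)) : Bool → Fin 3 → PathStep (Cell K) (SdEdge K)
  | false => ![.edge (.spoke f i false) true, firstHalf (K.attach f i),
      .edge (.spoke f i true) false]
  | true => ![.edge (.spoke f i true) true, secondHalf (K.attach f i),
      .edge (.spoke f (i + 1) false) false]

theorem firstHalf_src (s : PathStep K.V K.E) :
    (firstHalf s).src SdEdge.src SdEdge.tgt = .vert (s.src K.src K.tgt) := by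
  rcases s with ⟨e, _ | _⟩ | v <;> rfl

theorem firstHalf_tgt (s : PathStep K.V K.E) :
    (firstHalf s).tgt SdEdge.src SdEdge.tgt = mid s := by
  rcases s with ⟨e, _ | _⟩ | v <;> rfl

theorem secondHalf_src (s : PathStep K.V K.E) :
    (secondHalf s).src SdEdge.src SdEdge.tgt = mid s := by
  rcases s with ⟨e, _ | _⟩ | v <;> rfl

theorem secondHalf_tgt (s : PathStep K.V K.E) :
    (secondHalf s).tgt SdEdge.src SdEdge.tgt = .vert (s.tgt K.src K.tgt) := by
  rcases s with ⟨e, _ | _⟩ | v <;> rfl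

/-- The barycentric subdivision `K'`: its vertices are the (barycenters of the) cells of `K`. -/
def sd (K : CombComplex) : CombComplex where
  V := Cell K
  E := SdEdge K
  F := Σ f : K.F, Fin (K.len f) × Bool
  src := SdEdge.src
  tgt := SdEdge.tgt
  len _ := 3
  attach p := sdAttach p.1 p.2.1 p.2.2
  closed := by
    rintro ⟨f, i, b⟩ j
    cases b <;> fin_cases j
    · exact (firstHalf_src _).symm
    · exact firstHalf_tgt _
    · rfl
    · exact (secondHalf_src _).symm
    · exact (secondHalf_tgt _).trans (congrArg Cell.vert (K.closed f i))
    · rfl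

end CombComplex

/-- The boundary path of the 2-cell of a relator: one step for each letter; the boundary circle of
an empty relator is a single 1-cell mapped to the vertex. -/
def relatorPath {α : Type} : List (α × Bool) → List (PathStep Unit α)
  | [] => [.const ()]
  | w => w.map fun p => .edge p.1 p.2

theorem relatorPath_length_ne {α : Type} (w : List (α × Bool)) : (relatorPath w).length ≠ 0 := by
  cases w <;> simp [relatorPath]

/-- The standard complex `K_P`: one vertex, one loop for each generator, one 2-cell attached along
each relator. -/
def WordPresentation.standardComplex (P : WordPresentation) : CombComplex where
  V := Unit
  E := P.Gen
  F := P.Rel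
  src _ := ()
  tgt _ := ()
  len j := (relatorPath (P.word j)).length
  len_ne _ := ⟨relatorPath_length_ne _⟩
  attach j i := (relatorPath (P.word j)).get i
  closed _ _ := rfl

/-! ### Acyclic matchings -/

section Matching

variable {X : Type} [PartialOrder X]

/-- The edges of the Hasse diagram of `X`, those in `M` being reversed. -/
def ModifiedHasse (M : Set (X × X)) (a b : X) : Prop :=
  (a ⋖ b ∧ (a, b) ∉ M) ∨ (b ⋖ a ∧ (b, a) ∈ M)

structure IsAcyclicMatching (M : Set (X × X)) : Prop where
  covBy : ∀ p ∈ M, p.1 ⋖ p.2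
  /-- Each element is involved in at most one pair. -/
  matching : ∀ p ∈ M, ∀ q ∈ M, p.1 = q.1 ∨ p.1 = q.2 ∨ p.2 = q.1 ∨ p.2 = q.2 → p = q
  /-- There are no directed cycles. -/
  acyclic : ∀ a, ¬ Relation.TransGen (ModifiedHasse M) a a

/-- Not incident to any pair of `M`. -/
def IsCriticalElement (M : Set (X × X)) (a : X) : Prop := ∀ p ∈ M, a ≠ p.1 ∧ a ≠ p.2

end Matching

/-! ### The rewriting rule -/

section Words

variable {E : Type}

/-- `u ^ ε` with `ε = 1` for `true` and `ε = -1` for `false`. -/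
def signPow (u : List (E × Bool)) (b : Bool) : List (E × Bool) :=
  if b then u else FreeGroup.invRev u

/-- The equivalent expression `(w₁⁻¹ w₂⁻¹) ^ ε` of `x` induced by the relator `w₁ x ^ ε w₂`, where
`x` does not occur in `w₁`, `w₂` (when `x` does not occur at all, the value is irrelevant). -/
def equivExpr [DecidableEq E] (x : E) (w : List (E × Bool)) : List (E × Bool) :=
  match w.dropWhile (fun p => p.1 ≠ x) with
  | [] => []
  | p :: w₂ =>
    signPow (FreeGroup.invRev (w.takeWhile (fun p => p.1 ≠ x)) ++ FreeGroup.invRev w₂) p.2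

/-- Replace every occurrence of `x ^ ε` in `w` by `u ^ ε`. -/
def substWord [DecidableEq E] (x : E) (u w : List (E × Bool)) : List (E × Bool) :=
  w.flatMap fun p => if p.1 = x then signPow u p.2 else [p]

end Words

/-! ### The Morse presentation -/

/-- A stage of the procedure: the presentation with generators the 1-cells in `gens` and with one
relator `word f` for each 2-cell `f` in `rels`. -/
structure MorseStage (E F : Type) where
  gens : Set E
  rels : Set F
  word : F → List (E × Bool)

namespace MorseStage

variable {E F : Type}

/-- Remove the relator associated to `e` and the generator `x`, and apply the rewriting rule to
every occurrence of `x` in the remaining relators. -/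
def eliminate [DecidableEq E] (S : MorseStage E F) (p : E × F) : MorseStage E F where
  gens := S.gens \ {p.1}
  rels := S.rels \ {p.2}
  word f := substWord p.1 (equivExpr p.1 (S.word p.2)) (S.word f)

open Classical in
/-- The presentation described by a stage (all letters of the remaining relators lie in `gens`, for
every stage that arises from an acyclic matching, so that nothing is discarded here). -/
def toPresentation [Finite E] [Finite F] (S : MorseStage E F) : GroupPresentation where
  Gen := S.gens
  Rel := S.rels
  rel f := FreeGroup.mk ((S.word f).filterMap fun p =>
    if h : p.1 ∈ S.gens then some (⟨p.1, h⟩, p.2) else none)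

end MorseStage

namespace CombComplex

/-- The choices on which the Morse presentation depends: new orientations of 1-cells (those with
`flip x = true` are reversed), a base point and a direction for reading the attaching map of each
2-cell, and an enumeration `(x₁, e₁), …, (xₘ, eₘ)` of the matched pairs of 1-cells and 2-cells. -/
structure MorseChoices (K : CombComplex) (M : Set (Cell K × Cell K)) where
  flip : K.E → Bool
  word : K.F → List (K.E × Bool)
  word_spec : ∀ f, word f ~r K.boundaryWord f ∨ word f ~r FreeGroup.invRev (K.boundaryWord f)
  order : List (K.E × K.F)
  order_nodup : order.Nodup
  mem_order : ∀ x e, (x, e) ∈ order ↔ (Cell.edge x, Cell.face e) ∈ M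

open Classical in
/-- The presentation `𝒬₀`: the generators are the 1-cells not matched with a 0-cell, and the
relators are the words of all the 2-cells, where the matched 1-cells (which form the spanning tree)
are deleted. -/
def initialStage (K : CombComplex) (M : Set (Cell K × Cell K)) (C : MorseChoices K M) :
    MorseStage K.E K.F where
  gens := {x | ∀ v, (Cell.vert v, Cell.edge x) ∉ M}
  rels := Set.univ
  word f := ((C.word f).map fun p => (p.1, p.2 ^^ C.flip p.1)).filter
    fun p => ∀ v, (Cell.vert v, Cell.edge p.1) ∉ M

open Classical in
/-- The Morse presentation `𝒬_{K, M}`. -/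
def morsePresentation (K : CombComplex) (M : Set (Cell K × Cell K)) (C : MorseChoices K M) :
    GroupPresentation :=
  (C.order.foldl MorseStage.eliminate (K.initialStage M C)).toPresentation

end CombComplex

end

/-!
The proof has two independent parts, joined at the presentation `𝒬₀` which is read off the spanning
tree of edges matched with vertices.

*From `P` to `𝒬₀`.* Put `N` for the set of all triangles of the subdivision but the last one of
each 2-cell. By stabilizations `P` is equivalent to a presentation with generators `E ⊔ N`, in which
each `z ∈ N` is also a relator. The 1-cells of the subdivision are labelled by elements of the free
group on `E ⊔ N` (`sdLabel`) so that the first half of an edge of `K` and the spoke of a 2-cell to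
its first corner, which form a spanning tree, are trivial, the second half of an edge `e` is `e`,
and the boundary of a triangle in `N` has the generator of that triangle as value. Going around a
2-cell, the value of the last triangle then has to be the relator of the 2-cell modulo `N`, so that
all relators may be replaced by the values of the triangles (`qEquiv_triangleVal`). The free group
on `E ⊔ N` is thus the fundamental group of the 1-skeleton seen from the standard tree, and the
free group of `𝒬₀` is the same group seen from the matched tree. Each of the two labellings is the
image of the other one up to the coboundary of a potential on the vertices: `exists_hom_sdLabel` in
one direction, and `exists_potential` in the other, where the potential is defined by recursion
along the matched edges, acyclicity making the recursion well-founded. The composites of the two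
homomorphisms are inner automorphisms (`comp_eq_conj_of_gauge`), because a potential which is
constant along a spanning tree is constant. So both are isomorphisms, and they match the relators
up to conjugation and inversion, which is enough by `QEquiv.of_mulEquiv`.

*From `𝒬₀` to the Morse presentation.* If a generator `x` occurs exactly once in a relator, this
relator is `x u⁻¹` up to conjugation and inversion. The automorphism `x ↦ x u` turns it into `x`,
which can be deleted from the other relators by multiplying them with conjugates of it; removing
`x` then amounts to the substitution `x ↦ u` (`QEquiv.eliminate`). That this applies at every stage
follows from acyclicity: a letter of the relator of a 2-cell `f` at any stage is matched with `f` or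
has a directed path to `f` in the modified Hasse diagram, and a second occurrence of the letter
matched with `f` would close a directed cycle (`Admissible.eliminate`).
-/

noncomputable section

/-! ### `Q**`-equivalence of presentations -/

namespace QEquiv

variable {α β ρ σ : Type} [Finite α] [Finite β] [Finite ρ] [Finite σ]

theorem trans {P Q R : GroupPresentation} (h : QEquiv P Q) (h' : QEquiv Q R) : QEquiv P R :=
  Relation.ReflTransGen.trans h h'

theorem of_step {P Q : GroupPresentation} (h : QStep P Q) : QEquiv P Q :=
  Relation.ReflTransGen.single h

theorem of_eq {r r' : ρ → FreeGroup α} (h : ∀ j, r j = r' j) :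
    QEquiv ⟨α, ρ, r⟩ ⟨α, ρ, r'⟩ := by
  obtain rfl : r = r' := funext h
  exact Relation.ReflTransGen.refl

theorem relabel {r : ρ → FreeGroup α} {s : σ → FreeGroup β} (a : α ≃ β) (c : ρ ≃ σ)
    (h : ∀ j, s (c j) = FreeGroup.map a (r j)) : QEquiv ⟨α, ρ, r⟩ ⟨β, σ, s⟩ :=
  (of_step (.relabel r a c)).trans (of_eq fun j => by rw [← h, Equiv.apply_symm_apply])

/-- Relators may be replaced one at a time, provided that each replacement is a
`Q**`-equivalence whichever of the other relators have been replaced already. -/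
theorem of_forall_update [DecidableEq ρ] {r r' : ρ → FreeGroup α}
    (h : ∀ s : ρ → FreeGroup α, (∀ j, s j = r j ∨ s j = r' j) → ∀ j, s j = r j →
      QEquiv ⟨α, ρ, s⟩ ⟨α, ρ, Function.update s j (r' j)⟩) :
    QEquiv ⟨α, ρ, r⟩ ⟨α, ρ, r'⟩ := by
  have := Fintype.ofFinite ρ
  have key : ∀ t : Finset ρ, QEquiv ⟨α, ρ, r⟩ ⟨α, ρ, fun j => if j ∈ t then r' j else r j⟩ := by
    intro t
    induction t using Finset.induction_on with
    | empty => exact of_eq fun j => by simp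
    | insert a t ha ih =>
      refine ih.trans ((h _ (fun j => ?_) a (by simp [ha])).trans (of_eq fun j => ?_))
      · by_cases hj : j ∈ t <;> simp [hj]
      · by_cases hj : j = a
        · subst hj; simp
        · simp [hj]
  exact (key Finset.univ).trans (of_eq fun j => by simp)

theorem update_conj [DecidableEq ρ] (r : ρ → FreeGroup α) (j : ρ) {x : FreeGroup α}
    (h : IsConj (r j) x) : QEquiv ⟨α, ρ, r⟩ ⟨α, ρ, Function.update r j x⟩ := by
  obtain ⟨g, rfl⟩ := isConj_iff.1 h
  exact of_step (.conj r j g)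

theorem update_inv [DecidableEq ρ] (r : ρ → FreeGroup α) (j : ρ) :
    QEquiv ⟨α, ρ, r⟩ ⟨α, ρ, Function.update r j (r j)⁻¹⟩ :=
  of_step (.inv r j)

theorem of_isConj {r r' : ρ → FreeGroup α}
    (h : ∀ j, IsConj (r j) (r' j) ∨ IsConj (r j)⁻¹ (r' j)) :
    QEquiv ⟨α, ρ, r⟩ ⟨α, ρ, r'⟩ := by
  classical
  refine of_forall_update fun s _ j hj => ?_
  rcases h j with h | h
  · exact update_conj s j (hj ▸ h)
  · refine (update_inv s j).trans ((update_conj _ j (x := r' j) ?_).trans (of_eq fun k => ?_))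
    · simpa [hj] using h
    · simp

/-- A relator may be multiplied by a conjugate of another relator or of its inverse. -/
theorem update_mul_conj [DecidableEq ρ] (r : ρ → FreeGroup α) {i j : ρ} (hij : i ≠ j)
    {x : FreeGroup α} (h : IsConj (r i) x ∨ IsConj (r i)⁻¹ x) :
    QEquiv ⟨α, ρ, r⟩ ⟨α, ρ, Function.update r j (r j * x)⟩ := by
  have h₁ : QEquiv ⟨α, ρ, r⟩ ⟨α, ρ, Function.update r i x⟩ := of_isConj fun k => by
    by_cases hk : k = i
    · subst hk; simpa using h
    · rw [Function.update_of_ne hk]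
      exact Or.inl (IsConj.refl _)
  have h₂ := of_step (.mul (Function.update r i x) j i hij)
  refine h₁.trans (h₂.trans (of_isConj fun k => ?_))
  by_cases hk : k = i
  · subst hk
    simp only [Function.update_of_ne hij, Function.update_self]
    rcases h with h | h
    · exact Or.inl h.symm
    · refine Or.inr ?_
      obtain ⟨g, rfl⟩ := isConj_iff.1 h
      exact isConj_iff.2 ⟨g⁻¹, by group⟩
  · by_cases hk' : k = j
    · subst hk'
      left
      simpa [hij.symm] using IsConj.refl (r k * x)
    · left
      simpa [hk, hk'] using IsConj.refl (r k)

/-- The relators in `A` are used, and restored afterwards. -/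
theorem update_mul_normalClosure [DecidableEq ρ] (r : ρ → FreeGroup α) (A : Set ρ) {j : ρ}
    (hj : j ∉ A) {x : FreeGroup α} (hx : x ∈ Subgroup.normalClosure (r '' A)) :
    QEquiv ⟨α, ρ, r⟩ ⟨α, ρ, Function.update r j (r j * x)⟩ := by
  have step : ∀ x y : FreeGroup α, y ∈ Group.conjugatesOfSet (r '' A) → ∀ z, z = y ∨ z = y⁻¹ →
      QEquiv ⟨α, ρ, r⟩ ⟨α, ρ, Function.update r j (r j * x)⟩ →
      QEquiv ⟨α, ρ, r⟩ ⟨α, ρ, Function.update r j (r j * (x * z))⟩ := by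
    intro x y hy z hz ih
    obtain ⟨_, ⟨i, hi, rfl⟩, hy⟩ := Group.mem_conjugatesOfSet_iff.1 hy
    have hij : i ≠ j := fun h => hj (h ▸ hi)
    refine ih.trans ((update_mul_conj _ hij (x := z) ?_).trans (of_eq fun k => ?_))
    · rw [Function.update_of_ne hij]
      rcases hz with rfl | rfl
      · exact Or.inl hy
      · obtain ⟨g, rfl⟩ := isConj_iff.1 hy
        exact Or.inr (isConj_iff.2 ⟨g, by group⟩)
    · simp [mul_assoc]
  refine Subgroup.closure_induction_right (p := fun x _ =>
    QEquiv ⟨α, ρ, r⟩ ⟨α, ρ, Function.update r j (r j * x)⟩) ?_ ?_ ?_ hx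
  · exact of_eq fun k => by simp
  · exact fun x _ y hy ih => step x y hy y (Or.inl rfl) ih
  · exact fun x _ y hy ih => step x y hy y⁻¹ (Or.inr rfl) ih

/-- The relators outside `A` may be changed modulo the normal closure of those in `A`. -/
theorem of_normalClosure {r r' : ρ → FreeGroup α} (A : Set ρ) (hA : ∀ j ∈ A, r' j = r j)
    (h : ∀ j ∉ A, (r j)⁻¹ * r' j ∈ Subgroup.normalClosure (r '' A)) :
    QEquiv ⟨α, ρ, r⟩ ⟨α, ρ, r'⟩ := by
  classical
  refine of_forall_update fun s hs j hj => ?_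
  by_cases hjA : j ∈ A
  · refine of_eq fun k => ?_
    by_cases hk : k = j
    · subst hk; simp [hA k hjA, hj]
    · simp [hk]
  · have hsA : s '' A = r '' A := Set.image_congr fun k hk => by
      rcases hs k with h | h
      · exact h
      · rw [h, hA k hk]
    refine (update_mul_normalClosure s A hjA (hsA ▸ h j hjA)).trans (of_eq fun k => ?_)
    simp [hj]

/-- Presentations whose relators correspond, up to conjugation and inversion, under an isomorphism
of the free groups on the generators. -/
theorem of_mulEquiv {r : ρ → FreeGroup α} {s : σ → FreeGroup β} (φ : FreeGroup α ≃* FreeGroup β)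
    (c : ρ ≃ σ) (h : ∀ j, IsConj (φ (r j)) (s (c j)) ∨ IsConj (φ (r j))⁻¹ (s (c j))) :
    QEquiv ⟨α, ρ, r⟩ ⟨β, σ, s⟩ := by
  let a : α ≃ β := Equiv.ofFreeGroupEquiv φ
  refine (of_step (.relabel r a c)).trans
    ((of_step (.aut _ ((FreeGroup.freeGroupCongr a).symm.trans φ))).trans (of_isConj fun j => ?_))
  have h' := h (c.symm j)
  rw [c.apply_symm_apply] at h'
  have : ((FreeGroup.freeGroupCongr a).symm.trans φ) (FreeGroup.map a (r (c.symm j))) =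
      φ (r (c.symm j)) := by
    rw [MulEquiv.trans_apply]
    congr 1
    exact (FreeGroup.freeGroupCongr a).symm_apply_apply _
  rwa [this]

/-- Repeated stabilization: a whole family of generators, each with a relator equal to
it, may be added. -/
theorem add_sum (r : ρ → FreeGroup α) :
    QEquiv ⟨α, ρ, r⟩ ⟨α ⊕ β, ρ ⊕ β,
      Sum.elim (fun j => FreeGroup.map Sum.inl (r j)) (fun b => FreeGroup.of (Sum.inr b))⟩ := by
  refine Finite.induction_empty_option (P := fun γ => ∀ _ : Finite γ,
    QEquiv ⟨α, ρ, r⟩ ⟨α ⊕ γ, ρ ⊕ γ,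
      Sum.elim (fun j => FreeGroup.map Sum.inl (r j)) (fun b => FreeGroup.of (Sum.inr b))⟩)
    ?_ ?_ ?_ β inferInstance
  · intro γ δ e ih _
    have : Finite γ := .of_equiv _ e.symm
    refine (ih this).trans (relabel (Equiv.sumCongr (.refl _) e) (Equiv.sumCongr (.refl _) e) ?_)
    rintro (j | b)
    · simp [FreeGroup.map.comp]; rfl
    · simp
  · intro _
    refine relabel (Equiv.sumEmpty α PEmpty).symm (Equiv.sumEmpty ρ PEmpty).symm fun j => ?_
    simp; rfl
  · intro γ _ ih _
    refine (ih inferInstance).trans ((of_step (.add _)).trans ?_)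
    let e (α : Type) : Option (α ⊕ γ) ≃ α ⊕ Option γ :=
      { toFun := fun o => o.elim (.inr none) (Sum.map id some)
        invFun := Sum.elim (fun a => some (.inl a)) (fun o => o.map .inr)
        left_inv := by rintro (_ | _ | _) <;> rfl
        right_inv := by rintro (_ | _ | _) <;> rfl }
    refine relabel (e α) (e ρ) ?_
    rintro (_ | j | b)
    · simp [e]
    · simp [e, FreeGroup.map.comp]; rfl
    · simp [e]

open FreeGroup in
/-- Elimination of the generator `none`. -/
theorem eliminate_none (r : Option ρ → FreeGroup (Option α)) (u : FreeGroup α)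
    (h : IsConj (r none) (of none * (FreeGroup.map some u)⁻¹) ∨
      IsConj (r none)⁻¹ (of none * (FreeGroup.map some u)⁻¹)) :
    QEquiv ⟨Option α, Option ρ, r⟩
      ⟨α, ρ, fun j => FreeGroup.lift (fun o => o.elim u of) (r (some j))⟩ := by
  -- The automorphism `x ↦ x u` turns the relator `x u⁻¹` into `x`.
  let v : FreeGroup (Option α) := FreeGroup.map some u
  let f (w : FreeGroup (Option α)) : FreeGroup (Option α) →* FreeGroup (Option α) :=
    FreeGroup.lift fun o => o.elim (of none * w) fun a => of (some a)
  have f_some : ∀ w, (f w).comp (FreeGroup.map some) = FreeGroup.map some := fun w =>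
    FreeGroup.ext_hom _ _ fun a => by simp [f]
  have f_map : ∀ w (z : FreeGroup α), f w (FreeGroup.map some z) = FreeGroup.map some z :=
    fun w z => DFunLike.congr_fun (f_some w) z
  have f_none : ∀ w, f w (of none) = of none * w := fun w => by simp [f]
  have f_of_some : ∀ w a, f w (of (some a)) = of (some a) := fun w a => by simp [f]
  let θ : FreeGroup (Option α) ≃* FreeGroup (Option α) := MonoidHom.toMulEquiv (f v) (f v⁻¹)
    (FreeGroup.ext_hom _ _ (by
      rintro (_ | a)
      · simp [f_none, v, f_map]
      · simp [f_of_some]))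
    (FreeGroup.ext_hom _ _ (by
      rintro (_ | a)
      · simp only [MonoidHom.comp_apply, f_none, v, _root_.map_mul, f_map, ← _root_.map_inv,
          MonoidHom.id_apply]
        simp
      · simp [f_of_some]))
  -- Start with the relator in the form `x u⁻¹`.
  let r₁ : Option ρ → FreeGroup (Option α) := fun o => o.elim (of none * v⁻¹) fun j => r (some j)
  let ψ : FreeGroup (Option α) →* FreeGroup α := FreeGroup.lift fun o => o.elim u of
  -- Modulo the relator `x`, the automorphism is the substitution of `u` for `x`.
  let r₂ : Option ρ → FreeGroup (Option α) := fun o =>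
    o.elim (of none) fun j => FreeGroup.map some (ψ (r (some j)))
  have h₁ : QEquiv ⟨_, _, r⟩ ⟨_, _, r₁⟩ := of_isConj (by
    rintro (_ | j)
    · exact h
    · exact Or.inl (IsConj.refl _))
  have hθ : θ (r₁ none) = of none := by
    change f v (of none * v⁻¹) = _
    rw [_root_.map_mul, f_none, _root_.map_inv, f_map]
    exact mul_inv_cancel_right _ _
  have h₂ : QEquiv ⟨_, _, fun o => θ (r₁ o)⟩ ⟨_, _, r₂⟩ := by
    refine of_normalClosure {none} ?_ ?_
    · rintro _ rfl
      exact hθ.symm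
    · rintro (_ | j) hj
      · exact absurd rfl hj
      · rw [Set.image_singleton, hθ]
        set N := Subgroup.normalClosure {(of none : FreeGroup (Option α))}
        have : (QuotientGroup.mk' N).comp (f v) =
            (QuotientGroup.mk' N).comp ((FreeGroup.map some).comp ψ) := by
          refine FreeGroup.ext_hom _ _ ?_
          rintro (_ | a)
          · have h1 : (QuotientGroup.mk' N) (of none) = 1 :=
              (QuotientGroup.eq_one_iff _).2 (Subgroup.subset_normalClosure rfl)
            simp only [MonoidHom.comp_apply, f_none, _root_.map_mul, h1, one_mul]
            simp [ψ, v]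
          · simp [f_of_some, ψ]
        exact QuotientGroup.eq.1 (DFunLike.congr_fun this (r (some j)))
  exact h₁.trans ((of_step (.aut r₁ θ)).trans (h₂.trans (of_step (.remove _))))

/-- Elimination of a generator: if a relator is, up to conjugation and inversion, `x u⁻¹` with `u`
a word in the other generators, then this relator and `x` may be removed and `x` replaced by `u` in
the other relators. The substitution is the homomorphism `ψ`, and `u = ψ x`. -/
theorem eliminate {r : σ → FreeGroup β} {r' : ρ → FreeGroup α} (a : Option α ≃ β)
    (c : Option ρ ≃ σ) (ψ : FreeGroup β →* FreeGroup α)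
    (hψ : ∀ y, ψ (FreeGroup.of (a (some y))) = FreeGroup.of y)
    (h : IsConj (r (c none)) (FreeGroup.of (a none) *
        (FreeGroup.map (fun y => a (some y)) (ψ (FreeGroup.of (a none))))⁻¹) ∨
      IsConj (r (c none))⁻¹ (FreeGroup.of (a none) *
        (FreeGroup.map (fun y => a (some y)) (ψ (FreeGroup.of (a none))))⁻¹))
    (hr : ∀ j, r' j = ψ (r (c (some j)))) :
    QEquiv ⟨β, σ, r⟩ ⟨α, ρ, r'⟩ := by
  have h₁ : QEquiv ⟨β, σ, r⟩ ⟨Option α, Option ρ, fun o => FreeGroup.map a.symm (r (c o))⟩ :=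
    relabel a.symm c.symm fun j => by rw [Equiv.apply_symm_apply]
  have hcomp : ∀ z : FreeGroup α, FreeGroup.map a.symm (FreeGroup.map (fun y => a (some y)) z) =
      FreeGroup.map some z := fun z => by
    rw [FreeGroup.map.comp]
    congr 1
    ext y
    simp
  refine h₁.trans ((eliminate_none _ (ψ (FreeGroup.of (a none))) ?_).trans (of_eq fun j => ?_))
  · rcases h with h | h
    · left
      simpa [hcomp] using (FreeGroup.map a.symm).map_isConj h
    · right
      simpa [hcomp] using (FreeGroup.map a.symm).map_isConj h
  · rw [hr]
    have : (FreeGroup.lift fun o : Option α => o.elim (ψ (FreeGroup.of (a none))) FreeGroup.of).comp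
        (FreeGroup.map a.symm) = ψ := by
      refine FreeGroup.ext_hom _ _ fun b => ?_
      obtain ⟨o, rfl⟩ := a.surjective b
      rcases o with _ | y <;> simp [hψ]
    exact DFunLike.congr_fun this (r (c (some j)))

end QEquiv

/-! ### Words and the elimination of one generator -/

section Words

variable {E : Type}

/-- The retraction of a free group onto the free group on a subset of the generators, which kills
the other generators. -/
def freeGroupRetract (G : Set E) : FreeGroup E →* FreeGroup G :=
  open Classical in
  FreeGroup.lift fun e => if h : e ∈ G then FreeGroup.of ⟨e, h⟩ else 1

theorem freeGroupRetract_of_mem {G : Set E} {e : E} (h : e ∈ G) :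
    freeGroupRetract G (FreeGroup.of e) = FreeGroup.of ⟨e, h⟩ := by
  simp [freeGroupRetract, h]

theorem freeGroupRetract_of_notMem {G : Set E} {e : E} (h : e ∉ G) :
    freeGroupRetract G (FreeGroup.of e) = 1 := by
  simp [freeGroupRetract, h]

theorem FreeGroup.mk_cons_eq_mul (p : E × Bool) (w : List (E × Bool)) :
    FreeGroup.mk (p :: w) = FreeGroup.mk [p] * FreeGroup.mk w := by
  rw [FreeGroup.mul_mk, List.singleton_append]

theorem FreeGroup.mk_singleton (x : E) (b : Bool) :
    FreeGroup.mk [(x, b)] = if b then FreeGroup.of x else (FreeGroup.of x)⁻¹ := by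
  cases b
  · simp [FreeGroup.of, FreeGroup.inv_mk, FreeGroup.invRev]
  · rfl

theorem mk_filterMap_mem [DecidableEq E] (G : Set E) [DecidablePred (· ∈ G)]
    (w : List (E × Bool)) :
    FreeGroup.mk (w.filterMap fun p => if h : p.1 ∈ G then some ((⟨p.1, h⟩ : G), p.2) else none) =
      freeGroupRetract G (FreeGroup.mk w) := by
  induction w with
  | nil => rw [List.filterMap_nil, ← FreeGroup.one_eq_mk, ← FreeGroup.one_eq_mk, map_one]
  | cons p w ih =>
    obtain ⟨x, b⟩ := p
    rw [FreeGroup.mk_cons_eq_mul, _root_.map_mul, ← ih, FreeGroup.mk_singleton]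
    by_cases h : x ∈ G
    · rw [List.filterMap_cons_some (b := (⟨x, h⟩, b)) (by simp [h]),
        FreeGroup.mk_cons_eq_mul, FreeGroup.mk_singleton]
      cases b <;> simp [freeGroupRetract_of_mem h]
    · rw [List.filterMap_cons_none (by simp [h])]
      cases b <;> simp [freeGroupRetract_of_notMem h]

/-- Two homomorphisms which agree on the letters of a word agree on the word. -/
theorem map_mk_congr {H : Type} [Group H] {f g : FreeGroup E →* H} {w : List (E × Bool)}
    (h : ∀ x ∈ w.map Prod.fst, f (FreeGroup.of x) = g (FreeGroup.of x)) :
    f (FreeGroup.mk w) = g (FreeGroup.mk w) := by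
  induction w with
  | nil => rw [← FreeGroup.one_eq_mk, map_one, map_one]
  | cons p w ih =>
    obtain ⟨x, b⟩ := p
    rw [FreeGroup.mk_cons_eq_mul, _root_.map_mul, _root_.map_mul,
      ih fun y hy => h y (List.mem_cons_of_mem _ hy), FreeGroup.mk_singleton]
    have := h x (by simp)
    cases b <;> simp [this]

theorem mk_signPow (u : List (E × Bool)) (b : Bool) :
    FreeGroup.mk (signPow u b) = if b then FreeGroup.mk u else (FreeGroup.mk u)⁻¹ := by
  cases b <;> simp [signPow]

theorem map_fst_invRev (u : List (E × Bool)) :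
    (FreeGroup.invRev u).map Prod.fst = (u.map Prod.fst).reverse := by
  simp [FreeGroup.invRev, Function.comp_def]

theorem mem_map_fst_signPow {u : List (E × Bool)} {b : Bool} {y : E} :
    y ∈ (signPow u b).map Prod.fst ↔ y ∈ u.map Prod.fst := by
  cases b
  · simp only [signPow, Bool.false_eq_true, if_false, map_fst_invRev, List.mem_reverse]
  · simp [signPow]

variable [DecidableEq E]

theorem substWord_cons (x : E) (u : List (E × Bool)) (p : E × Bool) (w : List (E × Bool)) :
    substWord x u (p :: w) = (if p.1 = x then signPow u p.2 else [p]) ++ substWord x u w := rfl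

theorem mk_substWord (x : E) (u w : List (E × Bool)) :
    FreeGroup.mk (substWord x u w) =
      FreeGroup.lift (fun e => if e = x then FreeGroup.mk u else FreeGroup.of e)
        (FreeGroup.mk w) := by
  induction w with
  | nil => rw [← FreeGroup.one_eq_mk, map_one]; rfl
  | cons p w ih =>
    obtain ⟨y, b⟩ := p
    rw [FreeGroup.mk_cons_eq_mul, _root_.map_mul, ← ih, substWord_cons, ← FreeGroup.mul_mk]
    congr 1
    by_cases h : y = x
    · cases b <;> simp [h, mk_signPow, FreeGroup.mk_singleton]
    · cases b <;> simp [h, FreeGroup.mk_singleton]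

theorem mem_map_fst_substWord {x y : E} {u w : List (E × Bool)}
    (h : y ∈ (substWord x u w).map Prod.fst) :
    y ∈ w.map Prod.fst ∨ x ∈ w.map Prod.fst ∧ y ∈ u.map Prod.fst := by
  induction w with
  | nil => exact absurd h (by simp [substWord])
  | cons p w ih =>
    rw [substWord_cons, List.map_append, List.mem_append] at h
    rcases h with h | h
    · by_cases hp : p.1 = x
      · rw [if_pos hp, mem_map_fst_signPow] at h
        exact Or.inr ⟨by simp [hp], h⟩
      · rw [if_neg hp] at h
        exact Or.inl (by simp at h; simp [h])
    · rcases ih h with h | ⟨h, h'⟩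
      · exact Or.inl (List.mem_cons_of_mem _ h)
      · exact Or.inr ⟨List.mem_cons_of_mem _ h, h'⟩

/-- A letter `y ≠ x` occurs as often after the substitution of `u` for `x` as before, unless the
substitution really inserts it. -/
theorem count_substWord {x y : E} {u w : List (E × Bool)} (hy : y ≠ x)
    (h : x ∈ w.map Prod.fst → y ∉ u.map Prod.fst) :
    ((substWord x u w).map Prod.fst).count y = (w.map Prod.fst).count y := by
  induction w with
  | nil => rfl
  | cons p w ih =>
    rw [substWord_cons, List.map_append, List.count_append,
      ih fun hx => h (List.mem_cons_of_mem _ hx), List.map_cons, List.count_cons, add_comm]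
    congr 1
    by_cases hp : p.1 = x
    · rw [if_pos hp, List.count_eq_zero_of_not_mem
        (fun h' => h (by simp [hp]) (mem_map_fst_signPow.1 h'))]
      simp [hp, hy.symm]
    · rw [if_neg hp]
      simp [List.count_singleton]

/-- The shape `w₁ x ^ ε w₂` of a word in which the letter `x` occurs exactly once. -/
theorem exists_split_of_count_eq_one {x : E} {w : List (E × Bool)}
    (h : (w.map Prod.fst).count x = 1) :
    ∃ w₁ b w₂, w = w₁ ++ (x, b) :: w₂ ∧ x ∉ w₁.map Prod.fst ∧ x ∉ w₂.map Prod.fst ∧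
      equivExpr x w = signPow (FreeGroup.invRev w₁ ++ FreeGroup.invRev w₂) b := by
  have hx : x ∈ w.map Prod.fst := List.count_pos_iff.1 (by omega)
  have hw := List.takeWhile_append_dropWhile (p := fun p : E × Bool => decide (p.1 ≠ x)) (l := w)
  have h₁ : x ∉ (w.takeWhile fun p => decide (p.1 ≠ x)).map Prod.fst := by
    intro hx
    obtain ⟨p, hp, hpx⟩ := List.mem_map.1 hx
    exact absurd hpx (by simpa using List.mem_takeWhile_imp hp)
  rcases hd : w.dropWhile (fun p : E × Bool => decide (p.1 ≠ x)) with _ | ⟨⟨y, b⟩, w₂⟩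
  · rw [hd, List.append_nil] at hw
    exact absurd hx (hw ▸ h₁)
  · have hy : y = x := by
      have := List.head_dropWhile_not (fun p : E × Bool => decide (p.1 ≠ x)) (l := w)
        (by rw [hd]; exact List.cons_ne_nil _ _)
      simp only [hd, List.head_cons] at this
      simpa using this
    subst hy
    rw [hd] at hw
    refine ⟨_, b, w₂, hw.symm, h₁, ?_, ?_⟩
    · intro hx₂
      rw [← hw, List.map_append, List.count_append, List.map_cons, List.count_cons_self] at h
      have := List.count_pos_iff.2 hx₂
      omega
    · simp only [equivExpr, hd]

theorem notMem_equivExpr {x : E} {w : List (E × Bool)} (h : (w.map Prod.fst).count x = 1) :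
    x ∉ (equivExpr x w).map Prod.fst := by
  obtain ⟨w₁, b, w₂, -, h₁, h₂, he⟩ := exists_split_of_count_eq_one h
  rw [he, mem_map_fst_signPow, List.map_append, map_fst_invRev, map_fst_invRev]
  simp_all

theorem mem_of_mem_equivExpr {x y : E} {w : List (E × Bool)} (h : (w.map Prod.fst).count x = 1)
    (hy : y ∈ (equivExpr x w).map Prod.fst) : y ∈ w.map Prod.fst := by
  obtain ⟨w₁, b, w₂, hw, -, -, he⟩ := exists_split_of_count_eq_one h
  rw [he, mem_map_fst_signPow, List.map_append, map_fst_invRev, map_fst_invRev, List.mem_append,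
    List.mem_reverse, List.mem_reverse] at hy
  rw [hw, List.map_append, List.mem_append, List.map_cons, List.mem_cons]
  tauto

end Words

/-- A set is obtained by adding `x` to its complement in it. -/
def optionDiffSingletonEquiv {X : Type} {s : Set X} {x : X} (hx : x ∈ s) :
    Option ↥(s \ {x}) ≃ s :=
  Equiv.ofBijective (fun o => o.elim ⟨x, hx⟩ fun y => ⟨y.1, y.2.1⟩) <| by
    constructor
    · rintro (_ | ⟨y, hy, hyx⟩) (_ | ⟨z, hz, hzx⟩) h
      · rfl
      · exact absurd (Subtype.mk.inj h).symm hzx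
      · exact absurd (Subtype.mk.inj h) hyx
      · exact congrArg some (Subtype.ext (Subtype.mk.inj h))
    · rintro ⟨y, hy⟩
      by_cases h : y = x
      · exact ⟨none, by simp [h]⟩
      · exact ⟨some ⟨y, hy, h⟩, rfl⟩

namespace MorseStage

variable {E F : Type}

theorem toPresentation_eq [Finite E] [Finite F] (S : MorseStage E F) :
    S.toPresentation =
      ⟨S.gens, S.rels, fun f => freeGroupRetract S.gens (FreeGroup.mk (S.word f))⟩ := by
  classical
  rw [toPresentation]
  congr 1
  funext f
  exact mk_filterMap_mem _ _

/-- Eliminating a generator by means of a relator in which it occurs exactly once is a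
`Q**`-equivalence. -/
theorem qEquiv_eliminate [Finite E] [Finite F] [DecidableEq E] (S : MorseStage E F) {x : E} {e : F}
    (hx : x ∈ S.gens) (he : e ∈ S.rels) (h : ((S.word e).map Prod.fst).count x = 1) :
    QEquiv S.toPresentation (S.eliminate (x, e)).toPresentation := by
  set u := equivExpr x (S.word e) with hu
  set ρ' := freeGroupRetract (S.gens \ {x}) with hρ'
  have hρ'x : ρ' (FreeGroup.of x) = 1 := freeGroupRetract_of_notMem fun h => h.2 rfl
  let ψ : FreeGroup S.gens →* FreeGroup ↥(S.gens \ {x}) :=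
    FreeGroup.lift fun y => if y.1 = x then ρ' (FreeGroup.mk u) else ρ' (FreeGroup.of y.1)
  have hψx : ψ (FreeGroup.of ⟨x, hx⟩) = ρ' (FreeGroup.mk u) := by simp [ψ]
  let ι : FreeGroup ↥(S.gens \ {x}) →* FreeGroup S.gens :=
    FreeGroup.map fun y => optionDiffSingletonEquiv hx (some y)
  have hι : ∀ w : List (E × Bool), x ∉ w.map Prod.fst →
      ι (ρ' (FreeGroup.mk w)) = freeGroupRetract S.gens (FreeGroup.mk w) := by
    intro w hw
    refine map_mk_congr (f := ι.comp ρ') fun y hy => ?_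
    have hyx : y ≠ x := fun h => hw (h ▸ hy)
    by_cases hyG : y ∈ S.gens
    · rw [MonoidHom.comp_apply, hρ', freeGroupRetract_of_mem (G := S.gens \ {x}) ⟨hyG, hyx⟩,
        freeGroupRetract_of_mem hyG]
      simp [ι]
      rfl
    · rw [MonoidHom.comp_apply, hρ', freeGroupRetract_of_notMem fun h => hyG h.1,
        freeGroupRetract_of_notMem hyG, map_one]
  rw [toPresentation_eq, toPresentation_eq]
  refine QEquiv.eliminate (optionDiffSingletonEquiv hx) (optionDiffSingletonEquiv he) ψ ?_ ?_ ?_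
  · rintro ⟨y, hy, hyx⟩
    change ψ (FreeGroup.of ⟨y, hy⟩) = _
    have : y ≠ x := hyx
    simp only [ψ, FreeGroup.lift_apply_of, this, if_false]
    exact freeGroupRetract_of_mem (G := S.gens \ {x}) ⟨hy, hyx⟩
  · change IsConj (freeGroupRetract S.gens (FreeGroup.mk (S.word e)))
      (FreeGroup.of ⟨x, hx⟩ * (ι (ψ (FreeGroup.of ⟨x, hx⟩)))⁻¹) ∨
      IsConj (freeGroupRetract S.gens (FreeGroup.mk (S.word e)))⁻¹
      (FreeGroup.of ⟨x, hx⟩ * (ι (ψ (FreeGroup.of ⟨x, hx⟩)))⁻¹)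
    rw [hψx, hι u (notMem_equivExpr h)]
    obtain ⟨w₁, b, w₂, hw, h₁, h₂, he'⟩ := exists_split_of_count_eq_one h
    rw [hu, he', mk_signPow, hw, ← FreeGroup.mul_mk, FreeGroup.mk_cons_eq_mul,
      FreeGroup.mk_singleton, ← FreeGroup.mul_mk,
      ← FreeGroup.inv_mk, ← FreeGroup.inv_mk]
    cases b
    · right
      simp only [Bool.false_eq_true, if_false, _root_.map_mul, _root_.map_inv,
        freeGroupRetract_of_mem hx]
      exact isConj_iff.2 ⟨freeGroupRetract S.gens (FreeGroup.mk w₂), by group⟩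
    · left
      simp only [if_true, _root_.map_mul, _root_.map_inv, freeGroupRetract_of_mem hx]
      exact isConj_iff.2 ⟨(freeGroupRetract S.gens (FreeGroup.mk w₁))⁻¹, by group⟩
  · rintro ⟨f, hf, hfe⟩
    change ρ' (FreeGroup.mk (substWord x u (S.word f))) =
      ψ (freeGroupRetract S.gens (FreeGroup.mk (S.word f)))
    rw [mk_substWord, ← MonoidHom.comp_apply, ← MonoidHom.comp_apply]
    refine DFunLike.congr_fun (FreeGroup.ext_hom _ _ fun y => ?_) _
    by_cases hyx : y = x
    · subst hyx
      simp [freeGroupRetract_of_mem hx, hψx]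
    · by_cases hy : y ∈ S.gens
      · simp [freeGroupRetract_of_mem hy, ψ, hyx]
      · simp only [MonoidHom.comp_apply, FreeGroup.lift_apply_of, hyx, if_false,
          freeGroupRetract_of_notMem hy, map_one]
        exact freeGroupRetract_of_notMem fun h => hy h.1

end MorseStage

/-! ### Acyclicity and the sequence of eliminations -/

namespace CombComplex

variable {K : CombComplex}

theorem mem_boundaryWord_iff {e : K.E} {f : K.F} :
    e ∈ (K.boundaryWord f).map Prod.fst ↔ ∃ i b, K.attach f i = .edge e b := by
  simp only [boundaryWord, List.mem_map, List.mem_filterMap, List.mem_ofFn]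
  constructor
  · rintro ⟨⟨e, b⟩, ⟨_, ⟨i, rfl⟩, h⟩, rfl⟩
    refine ⟨i, b, ?_⟩
    rcases hi : K.attach f i with ⟨e', b'⟩ | v
    · rw [hi] at h
      simp [PathStep.letter?] at h
      simp [h]
    · rw [hi] at h
      simp [PathStep.letter?] at h
  · rintro ⟨i, b, h⟩
    exact ⟨(e, b), ⟨_, ⟨i, rfl⟩, by rw [h]; rfl⟩, rfl⟩

theorem edge_covBy_face_iff {e : K.E} {f : K.F} :
    Cell.edge e ⋖ Cell.face f ↔ e ∈ (K.boundaryWord f).map Prod.fst := by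
  rw [mem_boundaryWord_iff]
  refine ⟨fun h => h.lt, fun h => ⟨h, ?_⟩⟩
  rintro (v | e' | f') h₁ h₂
  · exact h₁
  · exact h₁
  · exact h₂

theorem vert_covBy_edge_iff {v : K.V} {e : K.E} :
    Cell.vert v ⋖ Cell.edge e ↔ v = K.src e ∨ v = K.tgt e := by
  refine ⟨fun h => h.lt, fun h => ⟨h, ?_⟩⟩
  rintro (v | e' | f') h₁ h₂
  · exact h₁
  · exact h₂
  · exact h₂

variable {M : Set (Cell K × Cell K)}

/-- The invariant of the elimination procedure which makes the rewriting rule applicable: a letter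
of the relator of `f` is matched with `f` or has a directed path to `f` in the modified Hasse
diagram, and a letter matched with `f` occurs in it exactly once. -/
structure Admissible [DecidableEq K.E] (M : Set (Cell K × Cell K)) (S : MorseStage K.E K.F) :
    Prop where
  reach : ∀ f ∈ S.rels, ∀ y ∈ (S.word f).map Prod.fst, (Cell.edge y, Cell.face f) ∈ M ∨
    Relation.TransGen (ModifiedHasse M) (Cell.edge y) (Cell.face f)
  count : ∀ f ∈ S.rels, ∀ y, (Cell.edge y, Cell.face f) ∈ M →
    ((S.word f).map Prod.fst).count y = 1

theorem Admissible.eliminate [DecidableEq K.E] (hM : IsAcyclicMatching M)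
    {S : MorseStage K.E K.F} (hS : Admissible M S) {x : K.E} {e : K.F} (he : e ∈ S.rels)
    (hxe : (Cell.edge x, Cell.face e) ∈ M) : Admissible M (S.eliminate (x, e)) := by
  have hcount := hS.count e he x hxe
  have hx : ∀ f ∈ S.rels, f ≠ e → x ∈ (S.word f).map Prod.fst →
      Relation.TransGen (ModifiedHasse M) (Cell.edge x) (Cell.face f) := by
    intro f hf hfe hxf
    refine (hS.reach f hf x hxf).resolve_left fun h => hfe ?_
    simpa using hM.matching _ h _ hxe (Or.inl rfl)
  have hu : ∀ y ∈ (equivExpr x (S.word e)).map Prod.fst,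
      Relation.TransGen (ModifiedHasse M) (Cell.edge y) (Cell.face e) := by
    intro y hy
    refine (hS.reach e he y (mem_of_mem_equivExpr hcount hy)).resolve_left fun h => ?_
    have hyx : y = x := by simpa using hM.matching _ h _ hxe (Or.inr (Or.inr (Or.inr rfl)))
    exact notMem_equivExpr hcount (hyx ▸ hy)
  have hex : ModifiedHasse M (Cell.face e) (Cell.edge x) := Or.inr ⟨hM.covBy _ hxe, hxe⟩
  constructor
  · rintro f ⟨hf, hfe⟩ y hy
    rcases mem_map_fst_substWord hy with h | ⟨h, h'⟩
    · exact hS.reach f hf y h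
    · exact Or.inr (((hu y h').tail hex).trans (hx f hf hfe h))
  · rintro f ⟨hf, hfe⟩ y hy
    have hyx : y ≠ x := by
      rintro rfl
      exact hfe (by simpa using hM.matching _ hy _ hxe (Or.inl rfl))
    refine (count_substWord hyx fun h h' => ?_).trans (hS.count f hf y hy)
    -- Otherwise `f → y → ⋯ → e → x → ⋯ → f` would be a directed cycle.
    exact hM.acyclic _ ((((hu y h').tail hex).trans (hx f hf hfe h)).tail
      (Or.inr ⟨hM.covBy _ hy, hy⟩))

/-- The pairs of `l` may be eliminated in any order. -/
theorem qEquiv_foldl_eliminate [DecidableEq K.E] (hM : IsAcyclicMatching M)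
    (l : List (K.E × K.F)) (hl : l.Nodup) (hlM : ∀ p ∈ l, (Cell.edge p.1, Cell.face p.2) ∈ M)
    (S : MorseStage K.E K.F) (hS : Admissible M S) (hlS : ∀ p ∈ l, p.1 ∈ S.gens ∧ p.2 ∈ S.rels) :
    QEquiv S.toPresentation (l.foldl MorseStage.eliminate S).toPresentation := by
  induction l generalizing S with
  | nil => exact Relation.ReflTransGen.refl
  | cons p l ih =>
    obtain ⟨x, e⟩ := p
    have hxe := hlM _ List.mem_cons_self
    obtain ⟨hx, he⟩ := hlS _ List.mem_cons_self
    refine (S.qEquiv_eliminate hx he (hS.count e he x hxe)).trans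
      (ih (List.nodup_cons.1 hl).2 (fun q hq => hlM q (List.mem_cons_of_mem _ hq)) _
        (hS.eliminate hM he hxe) fun q hq => ?_)
    obtain ⟨hq₁, hq₂⟩ := hlS q (List.mem_cons_of_mem _ hq)
    have hqM := hlM q (List.mem_cons_of_mem _ hq)
    have hne : q ≠ (x, e) := fun h => (List.nodup_cons.1 hl).1 (h ▸ hq)
    refine ⟨⟨hq₁, fun h => hne ?_⟩, ⟨hq₂, fun h => hne ?_⟩⟩
    · have h : q.1 = x := h
      have := hM.matching _ hqM _ hxe (Or.inl (by simp [h]))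
      simp at this
      exact Prod.ext this.1 this.2
    · have h : q.2 = e := h
      have := hM.matching _ hqM _ hxe (Or.inr (Or.inr (Or.inr (by simp [h]))))
      simp at this
      exact Prod.ext this.1 this.2

theorem map_fst_flip {E : Type} (w : List (E × Bool)) (fl : E → Bool) :
    (w.map fun p => (p.1, p.2 ^^ fl p.1)).map Prod.fst = w.map Prod.fst := by
  simp

theorem MorseChoices.perm (C : MorseChoices K M) (f : K.F) :
    ((C.word f).map Prod.fst).Perm ((K.boundaryWord f).map Prod.fst) := by
  rcases C.word_spec f with h | h
  · exact h.perm.map _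
  · refine (h.perm.map _).trans ?_
    rw [map_fst_invRev]
    exact List.reverse_perm _

/-- Regularity, in the form that no boundary word repeats a 1-cell, gives the invariant at the
start. -/
theorem admissible_initialStage [DecidableEq K.E] (hM : IsAcyclicMatching M)
    (hK : ∀ f, ((K.boundaryWord f).map Prod.fst).Nodup) (C : MorseChoices K M) :
    Admissible M (K.initialStage M C) := by
  classical
  have hletters : ∀ f, ((K.initialStage M C).word f).map Prod.fst =
      ((C.word f).map Prod.fst).filter fun e => ∀ v, (Cell.vert v, Cell.edge e) ∉ M := by
    intro f
    rw [← map_fst_flip (C.word f) C.flip, List.filter_map]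
    congr 1
  constructor
  · intro f _ y hy
    rw [hletters] at hy
    have hcov := edge_covBy_face_iff.2 ((C.perm f).mem_iff.1 (List.mem_of_mem_filter hy))
    by_cases h : (Cell.edge y, Cell.face f) ∈ M
    · exact Or.inl h
    · exact Or.inr (.single (Or.inl ⟨hcov, h⟩))
  · intro f _ y hy
    have hmem := (C.perm f).mem_iff.2 (edge_covBy_face_iff.1 (hM.covBy _ hy))
    rw [hletters]
    refine List.count_eq_one_of_mem (((C.perm f).nodup_iff.2 (hK f)).filter _)
      (List.mem_filter.2 ⟨hmem, ?_⟩)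
    simp only [decide_eq_true_eq]
    intro v hv
    simpa using hM.matching _ hv _ hy (Or.inr (Or.inr (Or.inl rfl)))

theorem qEquiv_initialStage (hM : IsAcyclicMatching M)
    (hK : ∀ f, ((K.boundaryWord f).map Prod.fst).Nodup) (C : MorseChoices K M) :
    QEquiv (K.initialStage M C).toPresentation (K.morsePresentation M C) := by
  classical
  refine qEquiv_foldl_eliminate hM C.order C.order_nodup (fun p hp => (C.mem_order p.1 p.2).1 hp) _
    (admissible_initialStage hM hK C) fun p hp => ⟨fun v hv => ?_, trivial⟩
  simpa using hM.matching _ hv _ ((C.mem_order p.1 p.2).1 hp) (Or.inr (Or.inr (Or.inl rfl)))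

theorem sd_boundaryWord_nodup (K : CombComplex) (q : K.sd.F) :
    ((K.sd.boundaryWord q).map Prod.fst).Nodup := by
  obtain ⟨f, i, b⟩ := q
  cases b <;> rcases h : K.attach f i with ⟨e, _ | _⟩ | v <;>
    simp [boundaryWord, sd, sdAttach, List.ofFn_succ, h, firstHalf, secondHalf, PathStep.letter?,
      List.filterMap_cons]

end CombComplex

/-! ### Potentials on the vertices -/

namespace CombComplex

section Potential

variable {L : CombComplex} {M : Set (Cell L × Cell L)}

/-- The directed path from `w` through `e` to `v` which makes recursion along the matched edges
well-founded. -/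
theorem transGen_of_matched (hM : IsAcyclicMatching M) {v w : L.V} {e : L.E}
    (hve : (Cell.vert v, Cell.edge e) ∈ M) (hw : w = L.src e ∨ w = L.tgt e) (hne : w ≠ v) :
    Relation.TransGen (ModifiedHasse M) (Cell.vert w) (Cell.vert v) := by
  refine (Relation.TransGen.single (b := Cell.edge e) (Or.inl ⟨vert_covBy_edge_iff.2 hw, ?_⟩)).tail
    (Or.inr ⟨hM.covBy _ hve, hve⟩)
  intro h
  exact hne (by simpa using hM.matching _ h _ hve (Or.inr (Or.inr (Or.inr rfl))))

theorem wellFounded_transGen_vert (hM : IsAcyclicMatching M) : WellFounded fun v w : L.V =>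
    Relation.TransGen (ModifiedHasse M) (Cell.vert v) (Cell.vert w) :=
  have : IsTrans L.V fun v w => Relation.TransGen (ModifiedHasse M) (Cell.vert v) (Cell.vert w) :=
    ⟨fun _ _ _ => Relation.TransGen.trans⟩
  have : Std.Irrefl fun v w : L.V =>
      Relation.TransGen (ModifiedHasse M) (Cell.vert v) (Cell.vert w) :=
    ⟨fun _ => hM.acyclic _⟩
  Finite.wellFounded_of_trans_of_irrefl _

/-- Since the matched edges form a forest, every labelling of the edges by elements of a group
becomes trivial on them after multiplication by a coboundary. -/
theorem exists_potential {H : Type} [Group H] (hM : IsAcyclicMatching M)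
    (hL : ∀ e, L.src e ≠ L.tgt e) (ℓ : L.E → H) :
    ∃ h : L.V → H, ∀ v e, (Cell.vert v, Cell.edge e) ∈ M →
      h (L.src e) * ℓ e * (h (L.tgt e))⁻¹ = 1 := by
  classical
  let step (v : L.V)
      (ih : ∀ w, Relation.TransGen (ModifiedHasse M) (Cell.vert w) (Cell.vert v) → H) : H :=
    if hv : ∃ e, (Cell.vert v, Cell.edge e) ∈ M then
      if hs : L.tgt hv.choose = v then
        ih (L.src hv.choose) (transGen_of_matched hM hv.choose_spec (Or.inl rfl)
          fun h => hL _ (h.trans hs.symm)) * ℓ hv.choose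
      else ih (L.tgt hv.choose) (transGen_of_matched hM hv.choose_spec (Or.inr rfl) hs) *
        (ℓ hv.choose)⁻¹
    else 1
  obtain ⟨h, hfix⟩ : ∃ h : L.V → H, ∀ v, h v = step v fun w _ => h w :=
    ⟨_, (wellFounded_transGen_vert hM).fix_eq step⟩
  refine ⟨h, fun v e hve => ?_⟩
  have hv : ∃ e, (Cell.vert v, Cell.edge e) ∈ M := ⟨e, hve⟩
  have he : hv.choose = e := by
    simpa using hM.matching _ hv.choose_spec _ hve (Or.inl rfl)
  have hfix := hfix v
  simp only [step, dif_pos hv] at hfix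
  rw [he] at hfix
  by_cases hs : L.tgt e = v
  · rw [dif_pos hs] at hfix
    rw [hs, hfix, mul_inv_cancel]
  · have hs' : L.src e = v := by
      rcases vert_covBy_edge_iff.1 (hM.covBy _ hve) with h | h
      · exact h.symm
      · exact absurd h.symm hs
    rw [dif_neg hs] at hfix
    rw [hs', hfix, inv_mul_cancel_right, mul_inv_cancel]

/-- If only one vertex is critical, then the matched edges connect all the vertices. -/
theorem eq_of_matched {X : Type} (hM : IsAcyclicMatching M)
    (hne : ∀ e, L.src e ≠ L.tgt e)
    (hL : ∀ (v : L.V) (f : L.F), ¬ (Cell.vert v : Cell L) ⋖ Cell.face f)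
    (hcrit : ∃! v : L.V, IsCriticalElement M (Cell.vert v)) (k : L.V → X)
    (hk : ∀ v e, (Cell.vert v, Cell.edge e) ∈ M → k (L.src e) = k (L.tgt e)) (v w : L.V) :
    k v = k w := by
  obtain ⟨r, -, hr⟩ := hcrit
  suffices h : ∀ v, k v = k r from (h v).trans (h w).symm
  intro v
  induction v using (wellFounded_transGen_vert hM).induction with
  | _ v ih =>
    by_cases hv : IsCriticalElement M (Cell.vert v)
    · rw [hr v hv]
    obtain ⟨e, he⟩ : ∃ e, (Cell.vert v, Cell.edge e) ∈ M := by
      by_contra hcon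
      refine hv ?_
      rintro ⟨a, b⟩ hp
      have hcov := hM.covBy _ hp
      constructor
      · rintro rfl
        rcases b with w | e | f
        · exact hcov.lt
        · exact hcon ⟨e, hp⟩
        · exact hL v f hcov
      · rintro rfl
        rcases a with w | e | f <;> exact hcov.lt
    have hke := hk v e he
    rcases vert_covBy_edge_iff.1 (hM.covBy _ he) with h | h
    · rw [h, hke]
      exact ih _ (transGen_of_matched hM he (Or.inr rfl) fun h' => hne e (h.symm.trans h'.symm))
    · rw [h, ← hke]
      exact ih _ (transGen_of_matched hM he (Or.inl rfl) fun h' => hne e (h'.trans h))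

end Potential

end CombComplex

/-! ### Labellings of the subdivision -/

/-- If `φ` and `ψ` are given on generators by labellings which differ by the coboundaries of `h` and
of `h'`, then `ψ ∘ φ` is conjugation by the common value of `ψ (h v) * h' v`. -/
theorem comp_eq_conj_of_gauge {V E G H : Type} [Group G] [Group H] {src tgt : E → V} [Nonempty V]
    {p : E → G} {ℓ : E → H} {h : V → H} {h' : V → G} {φ : G →* H} {ψ : H →* G}
    (hφ : ∀ e, φ (p e) = h (src e) * ℓ e * (h (tgt e))⁻¹)
    (hψ : ∀ e, ψ (ℓ e) = h' (src e) * p e * (h' (tgt e))⁻¹)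
    (hp : Subgroup.closure (Set.range p) = ⊤)
    (hconn : ∀ k : V → G, (∀ e, p e = 1 → k (src e) = k (tgt e)) → ∀ v w, k v = k w) :
    ∃ c : G, ∀ y, ψ (φ y) = c * y * c⁻¹ := by
  have key : ∀ e, ψ (φ (p e)) =
      ψ (h (src e)) * h' (src e) * p e * (ψ (h (tgt e)) * h' (tgt e))⁻¹ := fun e => by
    rw [hφ, _root_.map_mul, _root_.map_mul, hψ, _root_.map_inv]
    group
  have hk := hconn (fun v => ψ (h v) * h' v) fun e he => by
    have := key e
    rw [he, map_one, map_one, mul_one] at this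
    exact (mul_inv_eq_one.1 this.symm)
  obtain ⟨v₀⟩ := ‹Nonempty V›
  refine ⟨ψ (h v₀) * h' v₀, fun y => ?_⟩
  have : ψ.comp φ = (MulAut.conj (ψ (h v₀) * h' v₀)).toMonoidHom := by
    refine MonoidHom.eq_of_eqOn_dense hp ?_
    rintro _ ⟨e, rfl⟩
    rw [MonoidHom.comp_apply, key, hk _ v₀, hk (tgt e) v₀]
    rfl
  exact DFunLike.congr_fun this y

/-- A homomorphism is bijective if its composites with another one are inner automorphisms. -/
theorem bijective_of_comp_eq_conj {G H : Type} [Group G] [Group H] {φ : G →* H} {ψ : H →* G}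
    {c : G} {c' : H} (h : ∀ y, ψ (φ y) = c * y * c⁻¹) (h' : ∀ y, φ (ψ y) = c' * y * c'⁻¹) :
    Function.Bijective ψ := by
  constructor
  · intro x y hxy
    have := congrArg φ hxy
    rwa [h', h', mul_left_inj, mul_right_inj] at this
  · intro y
    exact ⟨φ (c⁻¹ * y * c), by rw [h]; group⟩

/-- Cyclic permutations of a word represent conjugate elements. -/
theorem isConj_mk_of_isRotated {E : Type} {w w' : List (E × Bool)} (h : w ~r w') :
    IsConj (FreeGroup.mk w) (FreeGroup.mk w') := by
  obtain ⟨n, rfl⟩ := h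
  induction n generalizing w with
  | zero => rw [List.rotate_zero]
  | succ n ih =>
    cases w with
    | nil => rw [List.rotate_nil]
    | cons p w =>
      rw [List.rotate_cons_succ]
      refine IsConj.trans ?_ ih
      rw [FreeGroup.mk_cons_eq_mul, ← FreeGroup.mul_mk]
      exact isConj_iff.2 ⟨(FreeGroup.mk [p])⁻¹, by group⟩

/-- The value of a labelling of the edges on a step of a path. -/
def PathStep.val {V E G : Type} [Group G] (ℓ : E → G) : PathStep V E → G
  | .edge e true => ℓ e
  | .edge e false => (ℓ e)⁻¹
  | .const _ => 1

theorem map_stepVal {V E G H : Type} [Group G] [Group H] (ψ : G →* H) (ℓ : E → G)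
    (s : PathStep V E) : ψ (s.val ℓ) = s.val (fun e => ψ (ℓ e)) := by
  rcases s with ⟨e, _ | _⟩ | v <;> simp [PathStep.val]

/-- The coboundary of `g` changes the value of a step only at its ends. -/
theorem stepVal_gauge {V E G : Type} [Group G] (src tgt : E → V) (p : E → G) (g : V → G)
    (s : PathStep V E) :
    s.val (fun e => g (src e) * p e * (g (tgt e))⁻¹) =
      g (s.src src tgt) * s.val p * (g (s.tgt src tgt))⁻¹ := by
  rcases s with ⟨e, _ | _⟩ | v <;> simp [PathStep.val, PathStep.src, PathStep.tgt, mul_assoc]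

theorem lift_filterMap_letter {V E G : Type} [Group G] (ℓ : E → G) (l : List (PathStep V E)) :
    FreeGroup.lift ℓ (FreeGroup.mk (l.filterMap PathStep.letter?)) =
      (l.map (PathStep.val ℓ)).prod := by
  induction l with
  | nil => rw [List.filterMap_nil, ← FreeGroup.one_eq_mk, map_one]; rfl
  | cons s l ih =>
    rcases s with ⟨e, b⟩ | v
    · rw [List.filterMap_cons_some (f := PathStep.letter?) (b := (e, b)) rfl,
        FreeGroup.mk_cons_eq_mul, _root_.map_mul, ih, FreeGroup.mk_singleton,
        List.map_cons, List.prod_cons]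
      cases b <;> simp [PathStep.val]
    · rw [List.filterMap_cons_none (f := PathStep.letter?) rfl, ih, List.map_cons, List.prod_cons]
      simp [PathStep.val]

namespace CombComplex

variable {K : CombComplex}

/-- The value of a labelling of the edges of the subdivision on the boundary of a triangle, read
from the barycenter of the ambient 2-cell. -/
def triangleVal {G : Type} [Group G] (ℓ : SdEdge K → G) : K.sd.F → G
  | ⟨f, i, false⟩ =>
    ℓ (.spoke f i false) * (firstHalf (K.attach f i)).val ℓ * (ℓ (.spoke f i true))⁻¹
  | ⟨f, i, true⟩ =>
    ℓ (.spoke f i true) * (secondHalf (K.attach f i)).val ℓ * (ℓ (.spoke f (i + 1) false))⁻¹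

theorem lift_sd_boundaryWord {G : Type} [Group G] (ℓ : SdEdge K → G) (q : K.sd.F) :
    FreeGroup.lift ℓ (FreeGroup.mk (K.sd.boundaryWord q)) = triangleVal ℓ q := by
  refine (lift_filterMap_letter ℓ _).trans ?_
  obtain ⟨f, i, _ | _⟩ := q
  · simp [sd, sdAttach, List.ofFn_succ, triangleVal, PathStep.val, mul_assoc]
  · simp [sd, sdAttach, List.ofFn_succ, triangleVal, PathStep.val, mul_assoc]

theorem map_triangleVal {G H : Type} [Group G] [Group H] (ψ : G →* H) (ℓ : SdEdge K → G)
    (q : K.sd.F) : ψ (triangleVal ℓ q) = triangleVal (fun e => ψ (ℓ e)) q := by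
  obtain ⟨f, i, _ | _⟩ := q <;> simp [triangleVal, map_stepVal]

/-- The coboundary of `g` changes the value of a closed path only by a conjugation. -/
theorem triangleVal_gauge {G : Type} [Group G] (p : SdEdge K → G) (g : Cell K → G) (q : K.sd.F) :
    triangleVal (fun e => g e.src * p e * (g e.tgt)⁻¹) q =
      g (.face q.1) * triangleVal p q * (g (.face q.1))⁻¹ := by
  obtain ⟨f, i, _ | _⟩ := q
  · simp only [triangleVal, stepVal_gauge, firstHalf_src, firstHalf_tgt]
    simp only [SdEdge.src, SdEdge.tgt]
    group
  · simp only [triangleVal, stepVal_gauge, secondHalf_src, secondHalf_tgt]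
    simp only [SdEdge.src, SdEdge.tgt, K.closed]
    group

/-- The last triangle of a 2-cell in the cyclic order. -/
def lastTriangle (f : K.F) : K.sd.F :=
  ⟨f, ⟨K.len f - 1, Nat.sub_one_lt (NeZero.ne _)⟩, true⟩

/-- The triangles of the subdivision, except the last one of each 2-cell. -/
abbrev InnerTriangle (K : CombComplex) : Type := {q : K.sd.F // q ≠ lastTriangle q.1}

/-- A 2-cell corresponds to its last triangle, and an inner triangle to itself. -/
def faceSumInnerTriangleEquiv (K : CombComplex) : K.F ⊕ InnerTriangle K ≃ K.sd.F :=
  Equiv.ofBijective (Sum.elim lastTriangle Subtype.val) <| by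
    constructor
    · rintro (f | ⟨q, hq⟩) (f' | ⟨q', hq'⟩) h
      · exact congrArg Sum.inl (congrArg Sigma.fst h : f = f')
      · refine absurd ?_ hq'
        obtain rfl : lastTriangle f = q' := h
        rfl
      · refine absurd ?_ hq
        obtain rfl : q = lastTriangle f' := h
        rfl
      · exact congrArg Sum.inr (Subtype.ext h)
    · intro q
      by_cases h : q = lastTriangle q.1
      · exact ⟨.inl q.1, h.symm⟩
      · exact ⟨.inr ⟨q, h⟩, rfl⟩

/-- The generator of a triangle; the last triangle of each 2-cell has none. -/
def triangleGen (q : K.sd.F) : FreeGroup (K.E ⊕ InnerTriangle K) :=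
  open Classical in if h : q ≠ lastTriangle q.1 then FreeGroup.of (.inr ⟨q, h⟩) else 1

/-- The label of a half-edge: the first half of `e` is trivial, the second one is the
generator `e`. -/
def halfLabel : SdEdge K → FreeGroup (K.E ⊕ InnerTriangle K)
  | .half e true => FreeGroup.of (.inl e)
  | _ => 1

/-- The label of the spoke from the barycenter of `f` to its `n`-th corner, determined inductively
by the condition that the boundary of each triangle has as value the generator of that triangle. -/
def cornerLabel (f : K.F) : ℕ → FreeGroup (K.E ⊕ InnerTriangle K)
  | 0 => 1
  | n + 1 => (triangleGen ⟨f, Fin.ofNat _ n, true⟩)⁻¹ * ((triangleGen ⟨f, Fin.ofNat _ n, false⟩)⁻¹ *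
      cornerLabel f n * (firstHalf (K.attach f (Fin.ofNat _ n))).val halfLabel) *
      (secondHalf (K.attach f (Fin.ofNat _ n))).val halfLabel

/-- A labelling of the 1-cells of the subdivision, trivial on a spanning tree if `K` has one vertex,
for which the value of the boundary of each triangle but the last one of each 2-cell is a
generator. -/
def sdLabel : SdEdge K → FreeGroup (K.E ⊕ InnerTriangle K)
  | .spoke f i false => cornerLabel f i
  | .spoke f i true => (triangleGen ⟨f, i, false⟩)⁻¹ * cornerLabel f i *
      (firstHalf (K.attach f i)).val halfLabel
  | e => halfLabel e

theorem firstHalf_val_sdLabel (s : PathStep K.V K.E) :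
    (firstHalf s).val sdLabel = (firstHalf s).val halfLabel := by
  rcases s with ⟨e, _ | _⟩ | v <;> rfl

theorem secondHalf_val_sdLabel (s : PathStep K.V K.E) :
    (secondHalf s).val sdLabel = (secondHalf s).val halfLabel := by
  rcases s with ⟨e, _ | _⟩ | v <;> rfl

theorem triangleGen_lastTriangle (f : K.F) : triangleGen (lastTriangle f) = 1 :=
  dif_neg fun h => h rfl

theorem triangleGen_of_ne {q : K.sd.F} (h : q ≠ lastTriangle q.1) :
    triangleGen q = FreeGroup.of (.inr ⟨q, h⟩) :=
  dif_pos h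

theorem cornerLabel_succ (f : K.F) (i : Fin (K.len f)) :
    cornerLabel f (i + 1) = (triangleGen ⟨f, i, true⟩)⁻¹ * sdLabel (.spoke f i true) *
      (secondHalf (K.attach f i)).val halfLabel := by
  rw [cornerLabel, Fin.ofNat_val_eq_self]
  rfl

/-- In the cyclic order of the corners, `i + 1` is either the next number or `0`; the latter occurs
exactly at the last triangle. -/
theorem val_add_one_or (f : K.F) (i : Fin (K.len f)) :
    ((i + 1 : Fin (K.len f)) : ℕ) = i + 1 ∧ (⟨f, i, true⟩ : K.sd.F) ≠ lastTriangle f ∨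
      (i + 1 : Fin (K.len f)) = 0 ∧ (⟨f, i, true⟩ : K.sd.F) = lastTriangle f ∧
        (i : ℕ) + 1 = K.len f := by
  have hi := i.2
  have hval : ((i + 1 : Fin (K.len f)) : ℕ) = (i + 1) % K.len f := by
    rw [Fin.val_add, Fin.val_one', Nat.add_mod_mod]
  by_cases h : (i : ℕ) + 1 = K.len f
  · right
    refine ⟨Fin.ext ?_, ?_, h⟩
    · rw [hval, h, Nat.mod_self]; rfl
    · have : i = ⟨K.len f - 1, Nat.sub_one_lt (NeZero.ne _)⟩ := Fin.ext (by simp; omega)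
      exact congrArg (fun j => (⟨f, j, true⟩ : K.sd.F)) this
  · left
    refine ⟨by rw [hval, Nat.mod_eq_of_lt (by omega)], fun h' => h ?_⟩
    have h2 := congrArg (fun p : Fin (K.len f) × Bool => (p.1 : ℕ))
      (eq_of_heq (Sigma.mk.inj h').2)
    simp only at h2
    omega

theorem triangleVal_sdLabel_of_ne {q : K.sd.F} (h : q ≠ lastTriangle q.1) :
    triangleVal sdLabel q = triangleGen q := by
  obtain ⟨f, i, _ | _⟩ := q
  · simp only [triangleVal, firstHalf_val_sdLabel]
    simp only [sdLabel]
    group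
  · rcases val_add_one_or f i with ⟨hi, -⟩ | ⟨-, hi, -⟩
    · have : sdLabel (.spoke f (i + 1) false) = cornerLabel f (i + 1) := by
        rw [sdLabel, hi]
      rw [triangleVal, this, cornerLabel_succ, secondHalf_val_sdLabel]
      group
    · exact absurd hi h

theorem triangleVal_sdLabel_lastTriangle (f : K.F) :
    triangleVal sdLabel (lastTriangle f) = cornerLabel f (K.len f) := by
  rcases val_add_one_or f ⟨K.len f - 1, Nat.sub_one_lt (NeZero.ne _)⟩ with ⟨-, h⟩ | ⟨h, -, h'⟩
  · exact absurd rfl h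
  · rw [← h', cornerLabel_succ, lastTriangle, triangleVal, h, secondHalf_val_sdLabel]
    have : triangleGen (⟨f, ⟨K.len f - 1, Nat.sub_one_lt (NeZero.ne _)⟩, true⟩ : K.sd.F) = 1 :=
      triangleGen_lastTriangle f
    rw [this]
    simp [sdLabel, cornerLabel]

theorem firstHalf_mul_secondHalf_val (s : PathStep K.V K.E) :
    (firstHalf s).val halfLabel * (secondHalf s).val halfLabel =
      s.val fun e => (FreeGroup.of (Sum.inl e) : FreeGroup (K.E ⊕ InnerTriangle K)) := by
  rcases s with ⟨e, _ | _⟩ | v <;> simp [firstHalf, secondHalf, PathStep.val, halfLabel]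

/-- Modulo the generators of the triangles, the label of the last corner is the boundary word. -/
theorem map_cornerLabel_len {G : Type} [Group G] (π : FreeGroup (K.E ⊕ InnerTriangle K) →* G)
    (hπ : ∀ z, π (FreeGroup.of (.inr z)) = 1) (f : K.F) :
    π (cornerLabel f (K.len f)) =
      π (FreeGroup.map Sum.inl (FreeGroup.mk (K.boundaryWord f))) := by
  have hgen : ∀ q, π (triangleGen q) = 1 := by
    intro q
    by_cases h : q ≠ lastTriangle q.1
    · rw [triangleGen_of_ne h, hπ]
    · rw [not_not.1 h, triangleGen_lastTriangle, map_one]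
  have hcorner : ∀ n ≤ K.len f, π (cornerLabel f n) =
      ((((List.ofFn (K.attach f)).take n).map
        (PathStep.val fun e => π (FreeGroup.of (.inl e)))).prod) := by
    intro n
    induction n with
    | zero => intro _; simp [cornerLabel]
    | succ n ih =>
      intro hn
      have := ih (by omega)
      have hl : n < (List.ofFn (K.attach f)).length := by simpa using hn
      rw [List.take_succ_eq_append_getElem hl, List.map_append, List.prod_append, ← this,
        List.map_singleton, List.prod_singleton, List.getElem_ofFn, ← map_stepVal,
        ← firstHalf_mul_secondHalf_val]
      have hi : Fin.ofNat (K.len f) n = ⟨n, hn⟩ := Fin.ext (Nat.mod_eq_of_lt hn)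
      have ht := hgen ⟨f, ⟨n, hn⟩, true⟩
      have hf := hgen ⟨f, ⟨n, hn⟩, false⟩
      rw [cornerLabel, hi]
      simp only [_root_.map_mul, _root_.map_inv, ht, hf, inv_one, one_mul, mul_assoc]
  rw [hcorner _ le_rfl, List.take_of_length_le (by simp), ← lift_filterMap_letter,
    ← MonoidHom.comp_apply]
  refine DFunLike.congr_fun (FreeGroup.ext_hom _ _ fun e => ?_) _
  simp

/-- The presentation of a complex with one vertex is `Q**`-equivalent to the one which has in
addition the triangles of the subdivision, but for one in each 2-cell, as generators. -/
theorem qEquiv_triangleVal (K : CombComplex) :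
    QEquiv ⟨K.E, K.F, fun f => FreeGroup.mk (K.boundaryWord f)⟩
      ⟨K.E ⊕ InnerTriangle K, K.F ⊕ InnerTriangle K,
        fun x => triangleVal sdLabel (faceSumInnerTriangleEquiv K x)⟩ := by
  have hinr : ∀ z : InnerTriangle K,
      triangleVal sdLabel (faceSumInnerTriangleEquiv K (.inr z)) = FreeGroup.of (.inr z) := by
    intro z
    exact (triangleVal_sdLabel_of_ne z.2).trans (triangleGen_of_ne z.2)
  refine (QEquiv.add_sum (β := InnerTriangle K) _).trans
    (QEquiv.of_normalClosure (Set.range Sum.inr) ?_ ?_)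
  · rintro _ ⟨z, rfl⟩
    exact hinr z
  · rintro (f | z) hx
    · refine QuotientGroup.eq.1 (Eq.symm ?_)
      refine Eq.trans ?_ (map_cornerLabel_len (QuotientGroup.mk' _) (fun z => ?_) f)
      · exact congrArg _ (triangleVal_sdLabel_lastTriangle f)
      · exact (QuotientGroup.eq_one_iff _).2
          (Subgroup.subset_normalClosure ⟨.inr z, ⟨z, rfl⟩, rfl⟩)
    · exact absurd ⟨z, rfl⟩ hx

end CombComplex

/-! ### The presentation read off a spanning tree -/

namespace CombComplex

section InitialLabel

variable {L : CombComplex} {M : Set (Cell L × Cell L)} (C : L.MorseChoices M)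

/-- What a 1-cell contributes to the relators of the initial stage: `1` if it is matched with a
vertex, and otherwise its generator, or the inverse of it if the orientation is reversed. -/
def initialLabel (e : L.E) : FreeGroup (L.initialStage M C).gens :=
  freeGroupRetract _ (if C.flip e then (FreeGroup.of e)⁻¹ else FreeGroup.of e)

theorem initialLabel_of_mem {e : L.E} (h : e ∈ (L.initialStage M C).gens) :
    initialLabel C e = if C.flip e then (FreeGroup.of ⟨e, h⟩)⁻¹ else FreeGroup.of ⟨e, h⟩ := by
  rw [initialLabel]
  split_ifs
  · rw [_root_.map_inv, freeGroupRetract_of_mem h]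
  · rw [freeGroupRetract_of_mem h]

theorem initialLabel_of_notMem {e : L.E} (h : e ∉ (L.initialStage M C).gens) :
    initialLabel C e = 1 := by
  rw [initialLabel]
  split_ifs
  · rw [_root_.map_inv, freeGroupRetract_of_notMem h, inv_one]
  · rw [freeGroupRetract_of_notMem h]

theorem initialLabel_of_matched {v : L.V} {e : L.E} (h : (Cell.vert v, Cell.edge e) ∈ M) :
    initialLabel C e = 1 :=
  initialLabel_of_notMem C fun h' => h' v h

theorem closure_range_initialLabel : Subgroup.closure (Set.range (initialLabel C)) = ⊤ := by
  rw [eq_top_iff, ← FreeGroup.closure_range_of, Subgroup.closure_le]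
  rintro _ ⟨⟨e, he⟩, rfl⟩
  have h := Subgroup.subset_closure (Set.mem_range_self (f := initialLabel C) e)
  rw [initialLabel_of_mem C he] at h
  split_ifs at h
  · exact inv_mem_iff.1 h
  · exact h

theorem retract_mk_initialStage_word (f : L.F) :
    freeGroupRetract (L.initialStage M C).gens (FreeGroup.mk ((L.initialStage M C).word f)) =
      FreeGroup.lift (initialLabel C) (FreeGroup.mk (C.word f)) := by
  classical
  have key : ∀ w : List (L.E × Bool), freeGroupRetract (L.initialStage M C).gens
      (FreeGroup.mk ((w.map fun p => (p.1, p.2 ^^ C.flip p.1)).filter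
        fun p => p.1 ∈ (L.initialStage M C).gens)) =
      FreeGroup.lift (initialLabel C) (FreeGroup.mk w) := by
    intro w
    induction w with
    | nil => simp [← FreeGroup.one_eq_mk]
    | cons p w ih =>
      obtain ⟨e, b⟩ := p
      rw [FreeGroup.mk_cons_eq_mul, _root_.map_mul, ← ih, FreeGroup.mk_singleton, List.map_cons]
      by_cases he : e ∈ (L.initialStage M C).gens
      · rw [List.filter_cons_of_pos (by simpa using he), FreeGroup.mk_cons_eq_mul, _root_.map_mul,
          FreeGroup.mk_singleton]
        congr 1
        cases b <;> cases hfl : C.flip e <;>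
          simp [initialLabel_of_mem C he, freeGroupRetract_of_mem he, hfl]
      · rw [List.filter_cons_of_neg (by simpa using he)]
        cases b <;> simp [initialLabel_of_notMem C he]
  rw [← key]
  congr 2

theorem isConj_lift_word {G : Type} [Group G] (ℓ : L.E → G) (f : L.F) :
    IsConj (FreeGroup.lift ℓ (FreeGroup.mk (L.boundaryWord f)))
        (FreeGroup.lift ℓ (FreeGroup.mk (C.word f))) ∨
      IsConj (FreeGroup.lift ℓ (FreeGroup.mk (L.boundaryWord f)))⁻¹
        (FreeGroup.lift ℓ (FreeGroup.mk (C.word f))) := by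
  rcases C.word_spec f with h | h
  · exact Or.inl ((FreeGroup.lift ℓ).map_isConj (isConj_mk_of_isRotated h).symm)
  · refine Or.inr ?_
    rw [← _root_.map_inv, FreeGroup.inv_mk]
    exact (FreeGroup.lift ℓ).map_isConj (isConj_mk_of_isRotated h).symm

end InitialLabel

variable {K : CombComplex}

theorem sd_src_ne_tgt (e : K.sd.E) : K.sd.src e ≠ K.sd.tgt e := by
  rcases e with ⟨e, _ | _⟩ | ⟨f, i, _ | _⟩
  · exact fun h => nomatch (h : Cell.vert (K.src e) = Cell.edge e)
  · exact fun h => nomatch (h : Cell.edge e = Cell.vert (K.tgt e))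
  · exact fun h => nomatch (h : Cell.face f = Cell.vert ((K.attach f i).src K.src K.tgt))
  · change Cell.face f ≠ mid (K.attach f i)
    rcases K.attach f i with ⟨e, b⟩ | v
    · exact fun h => nomatch (h : Cell.face f = Cell.edge e)
    · exact fun h => nomatch (h : Cell.face f = Cell.vert v)

/-- Every vertex of a triangle lies on one of its two spokes, so that it is not covered by the
triangle. -/
theorem sd_not_vert_covBy_face (v : K.sd.V) (q : K.sd.F) :
    ¬ (Cell.vert v : Cell K.sd) ⋖ Cell.face q := by
  intro h
  suffices ∃ e : K.sd.E, (v = K.sd.src e ∨ v = K.sd.tgt e) ∧ ∃ j b, K.sd.attach q j = .edge e b by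
    obtain ⟨e, hv, hq⟩ := this
    exact h.2 (c := Cell.edge e) hv hq
  obtain ⟨f, i, b⟩ := q
  obtain ⟨j, hj⟩ := h.lt
  cases b
  · have h₀ : ∃ j b, K.sd.attach ⟨f, i, false⟩ j = .edge (SdEdge.spoke f i false) b :=
      ⟨(0 : Fin 3), true, rfl⟩
    have h₂ : ∃ j b, K.sd.attach ⟨f, i, false⟩ j = .edge (SdEdge.spoke f i true) b :=
      ⟨(2 : Fin 3), false, rfl⟩
    fin_cases j
    · exact ⟨_, Or.inl hj, h₀⟩
    · exact ⟨SdEdge.spoke f i false, Or.inr (hj.trans (firstHalf_src (K.attach f i))), h₀⟩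
    · exact ⟨_, Or.inr hj, h₂⟩
  · have h₀ : ∃ j b, K.sd.attach ⟨f, i, true⟩ j = .edge (SdEdge.spoke f i true) b :=
      ⟨(0 : Fin 3), true, rfl⟩
    have h₂ : ∃ j b, K.sd.attach ⟨f, i, true⟩ j = .edge (SdEdge.spoke f (i + 1) false) b :=
      ⟨(2 : Fin 3), false, rfl⟩
    fin_cases j
    · exact ⟨_, Or.inl hj, h₀⟩
    · exact ⟨SdEdge.spoke f i true, Or.inr (hj.trans (secondHalf_src (K.attach f i))), h₀⟩
    · exact ⟨_, Or.inr hj, h₂⟩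

theorem closure_range_sdLabel : Subgroup.closure (Set.range (sdLabel (K := K))) = ⊤ := by
  rw [eq_top_iff, ← FreeGroup.closure_range_of, Subgroup.closure_le]
  have hmem : ∀ e : SdEdge K, sdLabel e ∈ Subgroup.closure (Set.range (sdLabel (K := K))) :=
    fun e => Subgroup.subset_closure (Set.mem_range_self e)
  have hval : ∀ s : PathStep (Cell K) (SdEdge K),
      s.val sdLabel ∈ Subgroup.closure (Set.range (sdLabel (K := K))) := by
    rintro (⟨e, _ | _⟩ | v)
    · exact inv_mem (hmem e)
    · exact hmem e
    · exact one_mem _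
  rintro _ ⟨e | ⟨⟨f, i, b⟩, hz⟩, rfl⟩
  · exact hmem (.half e true)
  · rw [← triangleGen_of_ne hz, ← triangleVal_sdLabel_of_ne hz]
    cases b
    · exact mul_mem (mul_mem (hmem _) (hval _)) (inv_mem (hmem _))
    · exact mul_mem (mul_mem (hmem _) (hval _)) (inv_mem (hmem _))

/-- Paths in the standard spanning tree of the subdivision of a complex with one vertex (the first
halves of the edges and, for each 2-cell, the spoke to its first corner), evaluated by a labelling
`p`: the values of the paths from the vertex to the barycenters of the cells. -/
def treePath {G : Type} [Group G] (p : SdEdge K → G) : Cell K → G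
  | .vert _ => 1
  | .edge e => p (.half e false)
  | .face f => (p (.spoke f 0 false))⁻¹

/-- A labelling `p` of the subdivision of a complex with one vertex is the image of `sdLabel` under
a homomorphism, up to the coboundary of `treePath p`. -/
theorem exists_hom_sdLabel {G : Type} [Group G] (p : SdEdge K → G) :
    ∃ ψ : FreeGroup (K.E ⊕ InnerTriangle K) →* G, ∀ e,
      ψ (sdLabel e) = treePath p e.src * p e * (treePath p e.tgt)⁻¹ := by
  set g : SdEdge K → G := fun e => treePath p e.src * p e * (treePath p e.tgt)⁻¹ with hg
  let ψ : FreeGroup (K.E ⊕ InnerTriangle K) →* G := FreeGroup.lift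
    (Sum.elim (fun e => g (.half e true)) fun z => triangleVal g z.1)
  have hhalf : ∀ e b, ψ (halfLabel (.half e b)) = g (.half e b) := by
    rintro e (_ | _)
    · simp [halfLabel, hg, treePath, SdEdge.src, SdEdge.tgt]
    · simp [halfLabel, ψ]
  have hfirst : ∀ s : PathStep K.V K.E,
      ψ ((firstHalf s).val halfLabel) = (firstHalf s).val g := by
    rintro (⟨e, _ | _⟩ | v) <;> simp [firstHalf, PathStep.val, hhalf]
  have hsecond : ∀ s : PathStep K.V K.E,
      ψ ((secondHalf s).val halfLabel) = (secondHalf s).val g := by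
    rintro (⟨e, _ | _⟩ | v) <;> simp [secondHalf, PathStep.val, hhalf]
  have hgen : ∀ q : K.sd.F, q ≠ lastTriangle q.1 → ψ (triangleGen q) = triangleVal g q := by
    intro q hq
    rw [triangleGen_of_ne hq]
    simp [ψ]
  have hne : ∀ f i, (⟨f, i, false⟩ : K.sd.F) ≠ lastTriangle f := by
    intro f i h
    have := congrArg (fun p : Fin (K.len f) × Bool => p.2) (eq_of_heq (Sigma.mk.inj h).2)
    simp at this
  have htrue : ∀ f i, ψ (cornerLabel f (i : Fin (K.len f))) = g (.spoke f i false) →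
      ψ (sdLabel (.spoke f i true)) = g (.spoke f i true) := by
    intro f i h
    have ht := hgen ⟨f, i, false⟩ (hne f i)
    rw [sdLabel, _root_.map_mul, _root_.map_mul, _root_.map_inv, ht, h, hfirst, triangleVal]
    group
  -- The triangles between the first corner and the `n`-th one determine the label of the latter.
  have hcorner : ∀ f, ∀ n, ∀ h : n < K.len f, ψ (cornerLabel f n) = g (.spoke f ⟨n, h⟩ false) := by
    intro f n
    induction n with
    | zero =>
      intro h
      have : (⟨0, h⟩ : Fin (K.len f)) = 0 := rfl
      rw [this]
      simp [cornerLabel, hg, treePath, SdEdge.src, SdEdge.tgt]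
    | succ n ih =>
      intro h
      have hn : n < K.len f := by omega
      rcases val_add_one_or f ⟨n, hn⟩ with ⟨hi, hlast⟩ | ⟨-, -, hi⟩
      · have hi' : (⟨n, hn⟩ : Fin (K.len f)) + 1 = ⟨n + 1, h⟩ := Fin.ext hi
        have ht := hgen ⟨f, ⟨n, hn⟩, true⟩ hlast
        rw [cornerLabel_succ f ⟨n, hn⟩, _root_.map_mul, _root_.map_mul, _root_.map_inv, ht,
          htrue f ⟨n, hn⟩ (ih hn), hsecond, triangleVal, hi']
        group
      · simp only at hi
        omega
  refine ⟨ψ, ?_⟩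
  rintro (⟨e, b⟩ | ⟨f, i, _ | _⟩)
  · exact hhalf e b
  · exact hcorner f i i.2
  · exact htrue f i (hcorner f i i.2)

/-- The presentation of a complex with one vertex is `Q**`-equivalent to the one read off its
subdivision, for any spanning tree, orientations and readings of the attaching maps. -/
theorem qEquiv_sd_initialStage [Subsingleton K.V] {M : Set (Cell K.sd × Cell K.sd)}
    (hM : IsAcyclicMatching M) (hcrit : ∃! v : K.sd.V, IsCriticalElement M (Cell.vert v))
    (C : K.sd.MorseChoices M) :
    QEquiv ⟨K.E, K.F, fun f => FreeGroup.mk (K.boundaryWord f)⟩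
      (K.sd.initialStage M C).toPresentation := by
  have hV : Nonempty K.sd.V := ⟨hcrit.choose⟩
  have : Nonempty (Cell K) := hV
  obtain ⟨h, hh⟩ := exists_potential hM sd_src_ne_tgt (sdLabel (K := K))
  obtain ⟨ψ, hψ⟩ := exists_hom_sdLabel (K := K) (initialLabel C)
  let φ : FreeGroup (K.sd.initialStage M C).gens →* FreeGroup (K.E ⊕ InnerTriangle K) :=
    FreeGroup.lift fun e => if C.flip e.1
      then (h (K.sd.src e.1) * sdLabel e.1 * (h (K.sd.tgt e.1))⁻¹)⁻¹
      else h (K.sd.src e.1) * sdLabel e.1 * (h (K.sd.tgt e.1))⁻¹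
  have hφ : ∀ e : K.sd.E, φ (initialLabel C e) =
      h (K.sd.src e) * sdLabel e * (h (K.sd.tgt e))⁻¹ := by
    intro e
    by_cases he : e ∈ (K.sd.initialStage M C).gens
    · rw [initialLabel_of_mem C he]
      cases hfl : C.flip e <;> simp [φ, hfl, mul_assoc]
    · rw [initialLabel_of_notMem C he, map_one]
      have : ∃ v, (Cell.vert v, Cell.edge e) ∈ M := by
        by_contra hcon
        exact he fun v hv => hcon ⟨v, hv⟩
      obtain ⟨v, hv⟩ := this
      exact (hh v e hv).symm
  obtain ⟨c, hc⟩ := comp_eq_conj_of_gauge hφ hψ (closure_range_initialLabel C) fun k hk =>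
    eq_of_matched hM sd_src_ne_tgt sd_not_vert_covBy_face hcrit k fun v e hve =>
      hk e (initialLabel_of_matched C hve)
  obtain ⟨c', hc'⟩ := comp_eq_conj_of_gauge hψ hφ closure_range_sdLabel fun k hk => by
    by_cases hV : Nonempty K.V
    · obtain ⟨v₀⟩ := hV
      suffices hv : ∀ v, k v = k (Cell.vert v₀) from fun v w => (hv v).trans (hv w).symm
      rintro (v | e | f)
      · rw [Subsingleton.elim v v₀]
      · rw [← show k (Cell.vert (K.src e)) = k (Cell.edge e) from hk (.half e false) rfl,
          Subsingleton.elim (K.src e) v₀]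
      · rw [show k (Cell.face f) = k (Cell.vert _) from hk (.spoke f 0 false) rfl,
          Subsingleton.elim ((K.attach f 0).src K.src K.tgt) v₀]
    · have : IsEmpty K.V := not_nonempty_iff.1 hV
      intro v
      rcases v with v | e | f
      · exact isEmptyElim v
      · exact isEmptyElim (K.src e)
      · exact isEmptyElim ((K.attach f 0).src K.src K.tgt)
  let Ψ := MulEquiv.ofBijective ψ (bijective_of_comp_eq_conj hc hc')
  rw [MorseStage.toPresentation_eq]
  refine (qEquiv_triangleVal K).trans (QEquiv.of_mulEquiv Ψ
    ((faceSumInnerTriangleEquiv K).trans (Equiv.Set.univ _).symm) fun x => ?_)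
  set q := faceSumInnerTriangleEquiv K x
  have hconj : IsConj (Ψ (triangleVal sdLabel q)) (FreeGroup.lift (initialLabel C)
      (FreeGroup.mk (K.sd.boundaryWord q))) := by
    have h₁ : Ψ (triangleVal sdLabel q) = treePath (initialLabel C) (.face q.1) *
        triangleVal (initialLabel C) q * (treePath (initialLabel C) (.face q.1))⁻¹ :=
      (map_triangleVal ψ _ q).trans ((congrArg (fun ℓ => triangleVal ℓ q) (funext hψ)).trans
        (triangleVal_gauge (initialLabel C) (treePath (initialLabel C)) q))
    have h₂ : FreeGroup.lift (initialLabel C) (FreeGroup.mk (K.sd.boundaryWord q)) =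
        triangleVal (initialLabel C) q := lift_sd_boundaryWord (initialLabel C) q
    rw [h₁, h₂]
    exact (isConj_iff.2 ⟨_, rfl⟩ : IsConj _ _).symm
  change IsConj (Ψ (triangleVal sdLabel q)) (freeGroupRetract _
      (FreeGroup.mk ((K.sd.initialStage M C).word q))) ∨
    IsConj (Ψ (triangleVal sdLabel q))⁻¹ (freeGroupRetract _
      (FreeGroup.mk ((K.sd.initialStage M C).word q)))
  rw [retract_mk_initialStage_word]
  have hinv : IsConj (Ψ (triangleVal sdLabel q))⁻¹ (FreeGroup.lift (initialLabel C)
      (FreeGroup.mk (K.sd.boundaryWord q)))⁻¹ := by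
    obtain ⟨g, hg⟩ := isConj_iff.1 hconj
    exact isConj_iff.2 ⟨g, by rw [← hg]; group⟩
  exact (isConj_lift_word C _ q).imp hconj.trans hinv.trans

end CombComplex

theorem boundaryWord_standardComplex (P : WordPresentation) (j : P.Rel) :
    P.standardComplex.boundaryWord j = P.word j := by
  have : P.standardComplex.boundaryWord j =
      (relatorPath (P.word j)).filterMap PathStep.letter? :=
    congrArg (List.filterMap PathStep.letter?) (List.ofFn_get _)
  rw [this]
  rcases P.word j with _ | ⟨p, w⟩
  · rfl
  · rw [relatorPath, List.filterMap_map]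
    exact List.filterMap_some
    exact fun h => List.cons_ne_nil _ _ h

end

theorem mainTheorem2 (P : WordPresentation) (hP : P.Balanced)
    (M : Set (P.standardComplex.sd.Cell × P.standardComplex.sd.Cell))
    (hM : IsAcyclicMatching M)
    (hcrit : ∃! v : P.standardComplex.sd.V, IsCriticalElement M (CombComplex.Cell.vert v))
    (C : P.standardComplex.sd.MorseChoices M) :
    QEquiv P.toPresentation (P.standardComplex.sd.morsePresentation M C) := by
  have : Subsingleton P.standardComplex.V := inferInstanceAs (Subsingleton Unit)
  have h := CombComplex.qEquiv_sd_initialStage hM hcrit C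
  have hword : QEquiv P.toPresentation ⟨P.standardComplex.E, P.standardComplex.F,
      fun j => FreeGroup.mk (P.standardComplex.boundaryWord j)⟩ :=
    QEquiv.of_eq fun j => congrArg FreeGroup.mk (boundaryWord_standardComplex P j).symm
  exact (hword.trans h).trans (CombComplex.qEquiv_initialStage hM
    (CombComplex.sd_boundaryWord_nodup P.standardComplex) C)
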